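/- Let $n\ge 0$ and let $P\subset\mathbb{R}^n$ be an $n$-dimensional simple convex polytope (every vertex lies on exactly $n$ facets), with facets $F_1,\dots,F_r$. Let $e_1,\dots,e_r$ be the standard basis of $(\mathbb{Z}_2)^r$, and for $p\in P$ let $G_p\le(\mathbb{Z}_2)^r$ be the subgroup generated by the $e_i$ with $p\in F_i$. The real moment-angle manifold of $P$ is the quotient space $$\mathbb{R}\mathcal{Z}_P=P\times(\mathbb{Z}_2)^r/\!\sim,\qquad (p,g)\sim(p',g')\iff p=p'\text{ and }g^{-1}g'\in G_p ,$$ where $(\mathbb{Z}_2)^r$ is discrete. Then the following are equivalent: (i) $P$ is $2$-neighborly, i.e. any two facets of $P$ are adjacent (intersect); (ii) $\mathbb{R}\mathcal{Z}_P$ is simply connected. Moreover, let $M$ be any small cover over $P$, that is, a closed $n$-manifold with a locally standard $(\mathbb{Z}_2)^n$-action (every point has an invariant open neighbourhood that is equivariantly homeomorphic to an invariant open subset of a faithful linear representation of $(\mathbb{Z}_2)^n$ on $\mathbb{R}^n$) together with a homeomorphism of the orbit space $M/(\mathbb{Z}_2)^n$ with $P$ as manifolds with corners, i.e. such that an orbit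 has isotropy group of rank $k$ exactly when the corresponding point of $P$ lies on exactly $k$ facets. Then (i) and (ii) are also equivalent to (iii) $\pi_1(M)\cong(\mathbb{Z}_2)^{r-n}$ (for any choice of base point). -/

import Mathlib

/-- The elementary abelian `2`-group `(ℤ/2)^ι`, written multiplicatively. For finite `ι` its
topology (product of the discrete topologies) is discrete. -/
abbrev Z2Power (ι : Type*) : Type _ := Multiplicative (ι → ZMod 2)

/-- `F` is a facet of the convex set `P ⊆ ℝⁿ`: a nonempty (exposed) face of dimension `n - 1`.
For `n = 0` there are no facets. -/
def IsFacet {n : ℕ} (P F : Set (EuclideanSpace ℝ (Fin n))) : Prop :=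
  IsExposed ℝ P F ∧ F.Nonempty ∧ Module.finrank ℝ (vectorSpan ℝ F) + 1 = n

/-- The set of all facets of `P`. -/
def facets {n : ℕ} (P : Set (EuclideanSpace ℝ (Fin n))) :
    Set (Set (EuclideanSpace ℝ (Fin n))) :=
  {F | IsFacet P F}

/-- The facets of `P` that contain the point `p`. If `f(p)` is the face of `P` having `p` in its
relative interior, these are exactly the facets `F` with `f(p) ⊆ F`; if `P` is a simple polytope,
their number is the codimension of `f(p)`. -/
def facetsThrough {n : ℕ} (P : Set (EuclideanSpace ℝ (Fin n))) (p : EuclideanSpace ℝ (Fin n)) :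
    Set (Set (EuclideanSpace ℝ (Fin n))) :=
  {F | F ∈ facets P ∧ p ∈ F}

/-- `P` is an `n`-dimensional simple convex polytope in `ℝⁿ`: the convex hull of a finite set,
with nonempty interior, each of whose vertices lies on exactly `n` facets. -/
structure IsSimplePolytope {n : ℕ} (P : Set (EuclideanSpace ℝ (Fin n))) : Prop where
  exists_convexHull : ∃ t : Finset (EuclideanSpace ℝ (Fin n)), P = convexHull ℝ (t : Set _)
  interior_nonempty : (interior P).Nonempty
  simple : ∀ v ∈ P.extremePoints ℝ, (facetsThrough P v).encard = n

/-- `P` is `2`-neighborly: any two facets are adjacent, that is, they intersect. -/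
def IsTwoNeighborly {n : ℕ} (P : Set (EuclideanSpace ℝ (Fin n))) : Prop :=
  ∀ F ∈ facets P, ∀ G ∈ facets P, F ≠ G → (F ∩ G).Nonempty

/-- The basis vector `e_F` of `(ℤ/2)^r` attached to the facet `F`, where the `r` coordinates are
indexed by the facets of `P`. -/
noncomputable def facetVector {n : ℕ} (P : Set (EuclideanSpace ℝ (Fin n))) (F : facets P) :
    Z2Power (facets P) :=
  open Classical in Multiplicative.ofAdd (Pi.single F 1)

/-- The subgroup `G_{f(p)}` of `(ℤ/2)^r` generated by the `e_F` with `f(p) ⊆ F`, that is, with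
`p ∈ F`, where `f(p)` is the face of `P` having `p` in its relative interior. -/
def faceSubgroup {n : ℕ} (P : Set (EuclideanSpace ℝ (Fin n))) (p : EuclideanSpace ℝ (Fin n)) :
    Subgroup (Z2Power (facets P)) :=
  Subgroup.closure {g | ∃ F : facets P, p ∈ F.1 ∧ g = facetVector P F}

/-- The relation `(p, g) ∼ (p', g')` iff `p = p'` and `g⁻¹ g' ∈ G_{f(p)}` on `P × (ℤ/2)^r`. -/
def realMomentAngleSetoid {n : ℕ} (P : Set (EuclideanSpace ℝ (Fin n))) :
    Setoid (P × Z2Power (facets P)) where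
  r a b := a.1 = b.1 ∧ a.2⁻¹ * b.2 ∈ faceSubgroup P a.1
  iseqv :=
    { refl := fun a => ⟨rfl, by simp⟩
      symm := fun {a b} h => ⟨h.1.symm, by
        have h2 := (faceSubgroup P a.1).inv_mem h.2
        rw [h.1] at h2
        simpa using h2⟩
      trans := fun {a b c} h k => ⟨h.1.trans k.1, by
        have k2 := k.2
        rw [← h.1] at k2
        have h3 := (faceSubgroup P a.1).mul_mem h.2 k2
        simpa [mul_assoc] using h3⟩ }

/-- The real moment-angle manifold `ℝ𝒵_P = P × (ℤ/2)^r / ∼`, with the quotient topology. -/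
abbrev RealMomentAngle {n : ℕ} (P : Set (EuclideanSpace ℝ (Fin n))) : Type :=
  Quotient (realMomentAngleSetoid P)

/-- An action of `(ℤ/2)^n` on `M` is locally standard if every point has an invariant open
neighbourhood equivariantly homeomorphic to an invariant open subset of a faithful linear
representation of `(ℤ/2)^n` on `ℝⁿ`. (Invariance of the target follows from equivariance.) -/
def IsLocallyStandard (n : ℕ) (M : Type*) [TopologicalSpace M]
    [MulAction (Z2Power (Fin n)) M] : Prop :=
  ∀ x : M, ∃ ρ : Representation ℝ (Z2Power (Fin n)) (EuclideanSpace ℝ (Fin n)),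
    Function.Injective ρ ∧
    ∃ φ : OpenPartialHomeomorph M (EuclideanSpace ℝ (Fin n)), x ∈ φ.source ∧
      ∀ g : Z2Power (Fin n), ∀ y ∈ φ.source, g • y ∈ φ.source ∧ φ (g • y) = ρ g (φ y)

/-- The closed `n`-manifold `M` with its `(ℤ/2)^n`-action is a small cover over the simple
polytope `P`: the action is locally standard and its orbit space is homeomorphic to `P` as a
manifold with corners. The latter means that the homeomorphism preserves the codimension of
strata: the codimension of the stratum of an orbit is the rank `k` of its isotropy group (which
has `2 ^ k` elements), that of a point of `P` is the number of facets through it. -/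
def IsSmallCover {n : ℕ} (P : Set (EuclideanSpace ℝ (Fin n))) (M : Type*) [TopologicalSpace M]
    [T2Space M] [CompactSpace M] [ChartedSpace (EuclideanSpace ℝ (Fin n)) M]
    [MulAction (Z2Power (Fin n)) M] [ContinuousConstSMul (Z2Power (Fin n)) M] : Prop :=
  IsLocallyStandard n M ∧
  ∃ h : MulAction.orbitRel.Quotient (Z2Power (Fin n)) M ≃ₜ P, ∀ x : M,
    Nat.card (MulAction.stabilizer (Z2Power (Fin n)) x) =
      2 ^ (facetsThrough P (h (Quotient.mk _ x))).ncard

/-!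
Write `r` for the number of facets of `P`. The real moment-angle manifold is glued from chambers,
copies of `P` indexed by `(ℤ/2)^r`; more generally any group `W` with an element for each facet
defines such a space, the basic construction. A surjection of `W` onto another group that is
injective on the isotropy groups induces a covering of basic constructions, with the kernel as
group of deck transformations (`BasicConstruction.exists_isQuotientCoveringMap`).

If any two facets intersect, `ℝ𝒵_P` is simply connected (`IsTwoNeighborly.simplyConnectedSpace`). A
chamber is convex, so it lifts to the universal covering, and a lift of one chamber determines
lifts of the adjacent chambers which agree with it along the common facets. Passing to the adjacent
lift is an involution on the set of lifts of chambers, and the involutions of two intersecting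
facets commute because both compositions agree at a common point of the facets. Hence `(ℤ/2)^r`
acts on the lifts of chambers and the lifts in an orbit fit together to a section of the universal
covering. To avoid a topology on the universal covering, it is treated as the set of homotopy
classes of paths with transport along paths; the section is compatible with transport along
segments in the chambers, hence along all paths in the stars of points, which are contractible, and
hence along all paths.

If two facets `F` and `F'` are disjoint, then `(ℤ/2)^r` can be replaced by a central extension by
`ℤ/2` in which the generators of `F` and `F'` do not commute. The isotropy groups do not change
since no point lies on both facets. The basic construction is then a connected double covering of
`ℝ𝒵_P` (`IsMomentAngleQuotient.exists_surjective`), so `ℝ𝒵_P` is not simply connected.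

A small cover `M` over `P` has a section over `P` (`exists_section_orbitMap`), and so it is glued
from chambers indexed by `(ℤ/2)^n`. Its isotropy groups are described by a characteristic function
(`exists_characteristic_function`), which by local standardness makes `ℝ𝒵_P` a covering of `M` with
a group of order `2 ^ (r - n)` (`exists_isMomentAngleQuotient`). If `P` is 2-neighborly, this
covering is universal, and its group is `π₁(M)`. Otherwise, the double covering of `ℝ𝒵_P` above is
a connected covering of `M` of degree `2 ^ (r + 1 - n)`, and `π₁(M)` has at least this order.
-/

open Set Topology

/-! ### Facets of a polytope -/

section Facets

variable {n : ℕ} {P F G : Set (EuclideanSpace ℝ (Fin n))}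

lemma IsSimplePolytope.convex (hP : IsSimplePolytope P) : Convex ℝ P := by
  obtain ⟨t, rfl⟩ := hP.exists_convexHull
  exact convex_convexHull ℝ _

lemma IsSimplePolytope.isCompact (hP : IsSimplePolytope P) : IsCompact P := by
  obtain ⟨t, rfl⟩ := hP.exists_convexHull
  exact t.finite_toSet.isCompact_convexHull ℝ

lemma IsSimplePolytope.nonempty (hP : IsSimplePolytope P) : P.Nonempty :=
  hP.interior_nonempty.mono interior_subset

lemma IsFacet.subset (hF : IsFacet P F) : F ⊆ P := hF.1.subset

lemma IsFacet.isCompact (hF : IsFacet P F) (hP : IsCompact P) : IsCompact F :=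
  hF.1.isCompact hP

lemma IsFacet.convex (hF : IsFacet P F) (hP : Convex ℝ P) : Convex ℝ F :=
  hF.1.convex hP

/-- By Krein–Milman a facet is determined by its extreme points, which are among the finitely many
extreme points of the polytope. -/
lemma IsSimplePolytope.finite_facets (hP : IsSimplePolytope P) : (facets P).Finite := by
  obtain ⟨t, ht⟩ := hP.exists_convexHull
  refine Set.Finite.of_injOn (f := fun F => F.extremePoints ℝ) (t := {s | s ⊆ (t : Set _)}) ?_ ?_
    t.finite_toSet.finite_subsets
  · intro F hF
    refine (hF.1.isExtreme.extremePoints_subset_extremePoints).trans ?_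
    rw [ht]
    exact extremePoints_convexHull_subset
  · intro F hF G hG h
    dsimp only at h
    rw [← closure_convexHull_extremePoints (hF.isCompact hP.isCompact) (hF.convex hP.convex), h,
      closure_convexHull_extremePoints (hG.isCompact hP.isCompact) (hG.convex hP.convex)]

lemma IsSimplePolytope.finite_facets_coe (hP : IsSimplePolytope P) : Finite (facets P) :=
  hP.finite_facets

lemma IsFacet.openSegment_mem (hF : IsFacet P F) {x y z : EuclideanSpace ℝ (Fin n)}
    (hx : x ∈ P) (hy : y ∈ P) (hz : z ∈ openSegment ℝ x y) (hzF : z ∈ F) : x ∈ F ∧ y ∈ F :=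
  ⟨hF.1.isExtreme.left_mem_of_mem_openSegment hx hy hzF hz,
    hF.1.isExtreme.right_mem_of_mem_openSegment hx hy hzF hz⟩

/-- A facet is the set of maximizers of a linear functional, which vanishes on the direction of the
facet. -/
lemma IsFacet.exists_functional (hF : IsFacet P F) :
    ∃ (l : StrongDual ℝ (EuclideanSpace ℝ (Fin n))) (c : ℝ),
      F = {x ∈ P | l x = c} ∧ (∀ x ∈ P, l x ≤ c) ∧
        vectorSpan ℝ F ≤ LinearMap.ker l.toLinearMap := by
  obtain ⟨l, hl⟩ := hF.1 hF.2.1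
  obtain ⟨x₀, hx₀⟩ := hF.2.1
  have hx₀' := hx₀
  rw [hl] at hx₀'
  have hFl : F = {x ∈ P | l x = l x₀} := by
    ext x
    rw [hl]
    constructor
    · rintro ⟨hx, h⟩
      exact ⟨hx, le_antisymm (hx₀'.2 x hx) (h x₀ hx₀'.1)⟩
    · rintro ⟨hx, h⟩
      exact ⟨hx, fun y hy => h ▸ hx₀'.2 y hy⟩
  refine ⟨l, l x₀, hFl, hx₀'.2, ?_⟩
  rw [vectorSpan_def, Submodule.span_le]
  rintro _ ⟨x, hx, y, hy, rfl⟩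
  rw [hFl] at hx hy
  simp [hx.2, hy.2]

lemma IsFacet.eq_of_subset (hF : IsFacet P F) (hG : IsFacet P G) (h : F ⊆ G) : F = G := by
  refine h.antisymm fun x hx => ?_
  obtain ⟨l, c, hl, -, hker⟩ := hF.exists_functional
  have hspan : vectorSpan ℝ F = vectorSpan ℝ G :=
    Submodule.eq_of_le_of_finrank_eq (vectorSpan_mono ℝ h)
      (by have := hF.2.2; have := hG.2.2; omega)
  obtain ⟨y, hy⟩ := hF.2.1
  have h1 : l (x - y) = 0 :=
    hker (hspan ▸ vsub_mem_vectorSpan ℝ hx (h hy))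
  rw [hl] at hy ⊢
  refine ⟨hG.subset hx, ?_⟩
  rw [← hy.2]
  simpa [sub_eq_zero] using h1

/-- Interior points lie on no facet: a linear functional which is maximal at an interior point
is constant, so that it would cut out all of `P`, which has the wrong dimension. -/
lemma IsFacet.notMem_of_mem_interior (hF : IsFacet P F) {p : EuclideanSpace ℝ (Fin n)}
    (hp : p ∈ interior P) : p ∉ F := by
  intro hpF
  obtain ⟨l, c, hl, hmax, -⟩ := hF.exists_functional
  have hpc : l p = c := by rw [hl] at hpF; exact hpF.2
  have hloc : IsLocalMax l p := by
    filter_upwards [mem_interior_iff_mem_nhds.mp hp] with x hx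
    rw [hpc]
    exact hmax x hx
  have hl0 : l = 0 := by
    have := hloc.hasFDerivAt_eq_zero l.hasFDerivAt
    exact this
  have hFP : F = P := by
    rw [hl]
    ext x
    simp only [mem_ofPred_eq, and_iff_left_iff_imp]
    intro _
    rw [← hpc, hl0]
    simp
  have htop : vectorSpan ℝ F = ⊤ := by
    rw [hFP, ← direction_affineSpan]
    have : affineSpan ℝ P = ⊤ := by
      refine top_unique ?_
      rw [← isOpen_interior.affineSpan_eq_top ⟨p, hp⟩]
      exact affineSpan_mono ℝ interior_subset
    rw [this, AffineSubspace.direction_top]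
  have := hF.2.2
  rw [htop, finrank_top, finrank_euclideanSpace_fin] at this
  omega

/-- The points of the facet `F` that lie on no other facet. -/
def facetInterior (P F : Set (EuclideanSpace ℝ (Fin n))) : Set (EuclideanSpace ℝ (Fin n)) :=
  {p | p ∈ F ∧ ∀ G ∈ facets P, p ∈ G → G = F}

lemma IsFacet.openSegment_subset_facetInterior (hF : IsFacet P F) (hP : Convex ℝ P)
    {x y : EuclideanSpace ℝ (Fin n)} (hx : x ∈ facetInterior P F) (hy : y ∈ F) :
    openSegment ℝ x y ⊆ facetInterior P F := fun _ hz =>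
  ⟨(hF.convex hP).openSegment_subset hx.1 hy hz, fun G hG hzG =>
    hx.2 G hG (IsFacet.openSegment_mem hG (hF.subset hx.1) (hF.subset hy) hz hzG).1⟩

lemma IsFacet.convex_facetInterior (hF : IsFacet P F) (hP : Convex ℝ P) :
    Convex ℝ (facetInterior P F) := by
  rw [convex_iff_openSegment_subset]
  intro x hx y hy
  exact hF.openSegment_subset_facetInterior hP hx hy.1

lemma facetsThrough_eq_singleton_iff (hF : IsFacet P F) {p : EuclideanSpace ℝ (Fin n)} :
    facetsThrough P p = {F} ↔ p ∈ facetInterior P F := by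
  constructor
  · intro h
    have hpF : F ∈ facetsThrough P p := h ▸ mem_singleton F
    exact ⟨hpF.2, fun G hG hpG => by
      have : G ∈ facetsThrough P p := ⟨hG, hpG⟩
      rwa [h] at this⟩
  · intro h
    ext G
    exact ⟨fun hG => h.2 G hG.1 hG.2, fun hG => by
      rw [mem_singleton_iff.mp hG]; exact ⟨hF, h.1⟩⟩

/-- For each of the finitely many facets `G ≠ F` there is a point of `F` outside `G`. A facet
through a point of an open segment contains both endpoints, so averaging these points avoids all
`G`. -/
lemma IsSimplePolytope.facetInterior_nonempty (hP : IsSimplePolytope P) (hF : IsFacet P F) :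
    (facetInterior P F).Nonempty := by
  have key : ∀ S : Set (Set (EuclideanSpace ℝ (Fin n))), S.Finite → S ⊆ facets P →
      ∃ p ∈ F, ∀ G ∈ S, p ∈ G → G = F := by
    intro S hS
    induction S, hS using Set.Finite.induction_on with
    | empty =>
      intro _
      obtain ⟨p, hp⟩ := hF.2.1
      exact ⟨p, hp, by simp⟩
    | @insert G S _ _ ih =>
      intro hsub
      obtain ⟨p, hp, hpS⟩ := ih ((subset_insert _ _).trans hsub)
      have hG : IsFacet P G := hsub (mem_insert _ _)
      by_cases hGF : G = F
      · refine ⟨p, hp, ?_⟩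
        rintro H (rfl | hH) hpH
        · exact hGF
        · exact hpS H hH hpH
      · obtain ⟨q, hq, hqG⟩ : ∃ q ∈ F, q ∉ G := by
          by_contra! hcon
          exact hGF (hF.eq_of_subset hG hcon).symm
        obtain ⟨z, hz⟩ : (openSegment ℝ p q).Nonempty :=
          ⟨_, (1/2 : ℝ), 1/2, by norm_num, by norm_num, by norm_num, rfl⟩
        refine ⟨z, (hF.convex hP.convex).openSegment_subset hp hq hz, ?_⟩
        rintro H hH hzH
        have hHf : IsFacet P H := hsub hH
        have := hHf.openSegment_mem (hF.subset hp) (hF.subset hq) hz hzH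
        rcases hH with rfl | hH
        · exact absurd this.2 hqG
        · exact hpS H hH this.1
  obtain ⟨p, hp, h⟩ := key _ hP.finite_facets subset_rfl
  exact ⟨p, hp, h⟩

lemma IsSimplePolytope.subset_closure_facetInterior (hP : IsSimplePolytope P) (hF : IsFacet P F) :
    F ⊆ closure (facetInterior P F) := by
  intro y hy
  obtain ⟨x, hx⟩ := hP.facetInterior_nonempty hF
  have h1 := closure_mono (hF.openSegment_subset_facetInterior hP.convex hx hy)
  exact h1 (segment_subset_closure_openSegment (right_mem_segment ℝ x y))

/-- The open star of `p`: the points of `P` all of whose facets contain `p`. -/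
def openStar (P : Set (EuclideanSpace ℝ (Fin n))) (p : P) : Set P :=
  {q | ∀ F ∈ facets P, q.1 ∈ F → p.1 ∈ F}

lemma mem_openStar_self (p : P) : p ∈ openStar P p := fun _ _ h => h

lemma IsSimplePolytope.isOpen_openStar (hP : IsSimplePolytope P) (p : P) :
    IsOpen (openStar P p) := by
  have : openStar P p = ⋂ F ∈ {F | F ∈ facets P ∧ p.1 ∉ F}, {q : P | q.1 ∉ F} := by
    ext q
    simp only [openStar, mem_ofPred_eq, mem_iInter]
    exact ⟨fun h F hF hq => hF.2 (h F hF.1 hq), fun h F hF hq => by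
      by_contra hp
      exact h F ⟨hF, hp⟩ hq⟩
  rw [this]
  refine Set.Finite.isOpen_biInter (hP.finite_facets.subset fun F hF => hF.1) fun F hF => ?_
  have hc : IsClosed F := (IsFacet.isCompact hF.1 hP.isCompact).isClosed
  exact (hc.preimage continuous_subtype_val).isOpen_compl

lemma IsSimplePolytope.facetsThrough_finite (hP : IsSimplePolytope P)
    (p : EuclideanSpace ℝ (Fin n)) : (facetsThrough P p).Finite :=
  hP.finite_facets.subset fun _ h => h.1

lemma facetsThrough_eq_empty_of_mem_interior {p : EuclideanSpace ℝ (Fin n)}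
    (hp : p ∈ interior P) : facetsThrough P p = ∅ :=
  eq_empty_of_forall_notMem fun _ hF => IsFacet.notMem_of_mem_interior hF.1 hp hF.2

end Facets

/-! ### The basic construction -/

section BasicConstruction

variable {Y W G X : Type*} [Group W] [Group G]

/-- The equivalence relation `(y, w) ∼ (y', w')` iff `y = y'` and `w⁻¹ w' ∈ J y` on `Y × W`,
for a family of subgroups `J y` of `W`. -/
def mirrorSetoid (J : Y → Subgroup W) : Setoid (Y × W) where
  r a b := a.1 = b.1 ∧ a.2⁻¹ * b.2 ∈ J a.1
  iseqv :=
    { refl := fun a => ⟨rfl, by simp⟩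
      symm := fun {a b} h => ⟨h.1.symm, by
        have h2 := (J a.1).inv_mem h.2
        rw [h.1] at h2
        simpa using h2⟩
      trans := fun {a b c} h k => ⟨h.1.trans k.1, by
        have k2 := k.2
        rw [← h.1] at k2
        have h3 := (J a.1).mul_mem h.2 k2
        simpa [mul_assoc] using h3⟩ }

/-- The space `Y × W / ∼` obtained by gluing copies ("chambers") of `Y` indexed by the group `W`,
where the points `y` of the chambers `w` and `w'` are identified if `w⁻¹ w' ∈ J y`. -/
abbrev BasicConstruction (J : Y → Subgroup W) : Type _ := Quotient (mirrorSetoid J)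

namespace BasicConstruction

variable (J : Y → Subgroup W)

/-- The point `y` of the chamber `w`. -/
def mk (y : Y) (w : W) : BasicConstruction J := Quotient.mk (mirrorSetoid J) (y, w)

variable {J}

lemma mk_eq_mk {y y' : Y} {w w' : W} :
    mk J y w = mk J y' w' ↔ y = y' ∧ w⁻¹ * w' ∈ J y :=
  Quotient.eq

lemma mk_mul {y : Y} {w j : W} (hj : j ∈ J y) : mk J y (w * j) = mk J y w :=
  (mk_eq_mk.mpr ⟨rfl, by simpa using hj⟩).symm

lemma exists_rep (x : BasicConstruction J) : ∃ y w, mk J y w = x := by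
  obtain ⟨⟨y, w⟩, rfl⟩ := Quotient.exists_rep x
  exact ⟨y, w, rfl⟩

/-- `W` acts on the basic construction by permuting the chambers. -/
instance : MulAction W (BasicConstruction J) where
  smul v := Quotient.map' (fun a => (a.1, v * a.2)) fun a b h => ⟨h.1, by
    have h2 := h.2
    simpa [mul_assoc] using h2⟩
  one_smul x := by
    obtain ⟨y, w, rfl⟩ := exists_rep x
    exact congrArg (mk J y) (one_mul w)
  mul_smul v v' x := by
    obtain ⟨y, w, rfl⟩ := exists_rep x
    exact congrArg (mk J y) (mul_assoc v v' w)

variable [TopologicalSpace Y] [TopologicalSpace W] [DiscreteTopology W]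

omit [DiscreteTopology W] in
lemma isQuotientMap_mk : IsQuotientMap (fun a : Y × W => mk J a.1 a.2) :=
  isQuotientMap_quotient_mk'

omit [DiscreteTopology W] in
lemma continuous_mk (w : W) : Continuous fun y => mk J y w :=
  (continuous_quotient_mk' (s := mirrorSetoid J)).comp (Continuous.prodMk_left w)

instance : ContinuousConstSMul W (BasicConstruction J) where
  continuous_const_smul v := by
    refine isQuotientMap_mk.continuous_iff.mpr ?_
    have : Continuous fun a : Y × W => (a.1, v * a.2) :=
      continuous_fst.prodMk ((continuous_of_discreteTopology (f := (v * ·))).comp continuous_snd)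
    exact isQuotientMap_mk.continuous.comp this

/-- The points of `U` in the chambers around the point `y` of the chamber `w`. -/
def star (J : Y → Subgroup W) (U : Set Y) (y : Y) (w : W) : Set (BasicConstruction J) :=
  {x | ∃ z ∈ U, ∃ j ∈ J y, mk J z (w * j) = x}

omit [TopologicalSpace Y] [TopologicalSpace W] [DiscreteTopology W] in
lemma mk_mem_star_iff {U : Set Y} {y z : Y} {w v : W} (hU : ∀ z ∈ U, J z ≤ J y) :
    mk J z v ∈ star J U y w ↔ z ∈ U ∧ w⁻¹ * v ∈ J y := by
  constructor
  · rintro ⟨z', hz', j, hj, h⟩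
    obtain ⟨rfl, h'⟩ := mk_eq_mk.mp h
    refine ⟨hz', ?_⟩
    have := (J y).mul_mem hj (hU _ hz' h')
    simpa [mul_assoc] using this
  · rintro ⟨hz, hv⟩
    exact ⟨z, hz, _, hv, by simp⟩

lemma isOpen_star {U : Set Y} (hUo : IsOpen U) (y : Y) (w : W) (hU : ∀ z ∈ U, J z ≤ J y) :
    IsOpen (star J U y w) := by
  rw [← isQuotientMap_mk.isOpen_preimage]
  convert hUo.prod (isOpen_discrete {v | w⁻¹ * v ∈ J y})
  ext a
  exact mk_mem_star_iff hU

/-- A contraction `c` of `U` to `y` which does not shrink the groups `J z` induces a contraction of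
the star of `y`. -/
lemma contractibleSpace_star {U : Set Y} (hUo : IsOpen U) {y : Y} (hy : y ∈ U) (w : W)
    (hU : ∀ z ∈ U, J z ≤ J y) {c : Y → unitInterval → Y}
    (hc : Continuous fun a : Y × unitInterval => c a.1 a.2)
    (hc0 : ∀ z ∈ U, c z 0 = y) (hc1 : ∀ z ∈ U, c z 1 = z) (hcU : ∀ z ∈ U, ∀ t, c z t ∈ U)
    (hcJ : ∀ z ∈ U, ∀ t, J z ≤ J (c z t)) : ContractibleSpace (star J U y w) := by
  let m : Y × W → BasicConstruction J := fun a => mk J a.1 a.2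
  have hm : IsQuotientMap m := isQuotientMap_mk
  have hrep : ∀ x : star J U y w, ∃ a : Y × W, mk J a.1 a.2 = x.1 := fun x => hm.surjective x.1
  choose r hr using hrep
  have hrU : ∀ x, (r x).1 ∈ U ∧ w⁻¹ * (r x).2 ∈ J y := fun x =>
    (mk_mem_star_iff hU).mp (by rw [hr x]; exact x.2)
  let H : star J U y w × unitInterval → star J U y w := fun a =>
    ⟨mk J (c (r a.1).1 a.2) (r a.1).2,
      (mk_mem_star_iff hU).mpr ⟨hcU _ (hrU a.1).1 a.2, (hrU a.1).2⟩⟩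
  have hH : ∀ (z : Y) (v : W) (h : mk J z v ∈ star J U y w) (t : unitInterval),
      (H (⟨mk J z v, h⟩, t)).1 = mk J (c z t) v := by
    intro z v h t
    have hz := ((mk_mem_star_iff hU).mp h).1
    obtain ⟨h1, h2⟩ := mk_eq_mk.mp (hr ⟨mk J z v, h⟩)
    change mk J (c (r ⟨mk J z v, h⟩).1 t) (r ⟨mk J z v, h⟩).2 = _
    rw [h1] at h2 ⊢
    exact mk_eq_mk.mpr ⟨rfl, hcJ z hz t h2⟩
  have hHc : Continuous H := by
    refine (hm.restrictPreimage_isOpen (isOpen_star hUo y w hU)).continuous_lift_prod_left ?_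
    rw [continuous_induced_rng]
    have h1 : Continuous fun b : (m ⁻¹' star J U y w) × unitInterval =>
        m (c b.1.1.1 b.2, b.1.1.2) := by
      refine hm.continuous.comp (Continuous.prodMk ?_ (by fun_prop))
      exact hc.comp (by fun_prop : Continuous
        fun b : (m ⁻¹' star J U y w) × unitInterval => (b.1.1.1, b.2))
    exact h1.congr fun b => (hH b.1.1.1 b.1.1.2 b.1.2 b.2).symm
  have hyw : mk J y w ∈ star J U y w := (mk_mem_star_iff hU).mpr ⟨hy, by simp⟩
  rw [contractible_iff_id_nullhomotopic]
  refine ⟨⟨mk J y w, hyw⟩, ⟨ContinuousMap.Homotopy.symm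
    ⟨⟨fun a => H (a.2, a.1), hHc.comp continuous_swap⟩, fun x => ?_, fun x => ?_⟩⟩⟩
  · ext1
    obtain ⟨x, hx⟩ := x
    obtain ⟨z, v, rfl⟩ := exists_rep x
    have hz := (mk_mem_star_iff hU).mp hx
    refine (hH z v hx 0).trans ?_
    rw [hc0 z hz.1]
    exact (mk_eq_mk.mpr ⟨rfl, hz.2⟩).symm
  · ext1
    obtain ⟨x, hx⟩ := x
    obtain ⟨z, v, rfl⟩ := exists_rep x
    have hz := (mk_mem_star_iff hU).mp hx
    refine (hH z v hx 1).trans ?_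
    rw [hc1 z hz.1]
    rfl

omit [DiscreteTopology W] in
/-- Crossing from the chamber `w` to the chamber `w * j` is possible at a point fixed by `j`. -/
lemma pathConnectedSpace [PathConnectedSpace Y]
    (hJ : Subgroup.closure {w | ∃ y, w ∈ J y} = ⊤) : PathConnectedSpace (BasicConstruction J) := by
  obtain ⟨y₀⟩ := (inferInstance : Nonempty Y)
  have hch : ∀ (w : W) (y y' : Y), Joined (mk J y w) (mk J y' w) := fun w y y' =>
    (PathConnectedSpace.joined y y').map (continuous_mk w)
  have hmul : ∀ v ∈ Subgroup.closure {w | ∃ y, w ∈ J y}, ∀ w : W,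
      Joined (mk J y₀ w) (mk J y₀ (w * v)) := by
    intro v hv
    induction hv using Subgroup.closure_induction with
    | mem v hv =>
      intro w
      obtain ⟨y, hy⟩ := hv
      have h1 := hch w y₀ y
      rw [← mk_mul hy] at h1
      exact h1.trans (hch _ _ _)
    | one => intro w; rw [mul_one]
    | mul a b _ _ iha ihb =>
      intro w
      rw [← mul_assoc]
      exact (iha w).trans (ihb _)
    | inv a _ iha =>
      intro w
      have := (iha (w * a⁻¹)).symm
      rwa [inv_mul_cancel_right] at this
  have hbase : ∀ x : BasicConstruction J, Joined (mk J y₀ 1) x := by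
    intro x
    obtain ⟨y, w, rfl⟩ := exists_rep x
    have := hmul w (hJ ▸ Subgroup.mem_top w) 1
    rw [one_mul] at this
    exact this.trans (hch _ _ _)
  exact { nonempty := ⟨mk J y₀ 1⟩, joined := fun x x' => (hbase x).symm.trans (hbase x') }

/-- A surjection `f : W → G` which restricts to bijections `J y → I y` induces a covering of any
model `X` of the basic construction of `I` by that of `J`, with `f.ker` as group of deck
transformations: the open star of `(y, w)` is disjoint from its translates since `f.ker` meets the
conjugates of `J y` trivially. -/
theorem exists_isQuotientCoveringMap [TopologicalSpace G] [DiscreteTopology G] [TopologicalSpace X]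
    {I : Y → Subgroup G} {f : W →* G} (hf : Function.Surjective f)
    (hJ : ∀ y, ∀ᶠ z in 𝓝 y, J z ≤ J y) (hmap : ∀ y, (J y).map f = I y)
    (hinj : ∀ y, ∀ j ∈ J y, f j = 1 → j = 1)
    {Ψ : Y × G → X} (hΨ : IsQuotientMap Ψ)
    (hrel : ∀ a b, Ψ a = Ψ b ↔ a.1 = b.1 ∧ a.2⁻¹ * b.2 ∈ I a.1) :
    ∃ π : BasicConstruction J → X, IsQuotientCoveringMap π f.ker := by
  have hwd : ∀ a b : Y × W, mirrorSetoid J a b → Ψ (a.1, f a.2) = Ψ (b.1, f b.2) := by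
    intro a b h
    rw [hrel]
    refine ⟨h.1, ?_⟩
    rw [← hmap]
    exact ⟨_, h.2, by simp⟩
  refine ⟨Quotient.lift (fun a => Ψ (a.1, f a.2)) hwd, ?_⟩
  refine { toIsQuotientMap := ?_, continuous_const_smul := ?_, apply_eq_iff_mem_orbit := ?_,
           disjoint := ?_ }
  · have h1 : IsQuotientMap (fun a : Y × W => Ψ (a.1, f a.2)) := by
      have h2 : IsQuotientMap (Prod.map id f : Y × W → Y × G) := by
        refine IsOpenQuotientMap.isQuotientMap ?_
        exact IsOpenQuotientMap.id.prodMap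
          ⟨hf, continuous_of_discreteTopology, fun _ _ => isOpen_discrete _⟩
      exact hΨ.comp h2
    refine IsQuotientMap.of_comp (f := fun a : Y × W => mk J a.1 a.2)
      isQuotientMap_mk.continuous ?_ h1
    exact continuous_quot_lift hwd h1.continuous
  · intro k
    exact continuous_const_smul (k : W)
  · intro x x'
    obtain ⟨y, w, rfl⟩ := exists_rep x
    obtain ⟨y', w', rfl⟩ := exists_rep x'
    change Ψ (y, f w) = Ψ (y', f w') ↔ _
    rw [hrel]
    constructor
    · rintro ⟨h1, h2⟩
      obtain rfl : y = y' := h1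
      simp only [← hmap] at h2
      obtain ⟨j, hj, hjw⟩ := h2
      -- `k = w j w'⁻¹` lies in the kernel and maps the second point to the first one
      refine ⟨⟨w * j * w'⁻¹, by rw [MonoidHom.mem_ker]; simp [hjw]⟩, ?_⟩
      change mk J y (w * j * w'⁻¹ * w') = _
      rw [inv_mul_cancel_right, mk_mul hj]
    · rintro ⟨⟨k, hk⟩, h⟩
      change mk J y' (k * w') = _ at h
      obtain ⟨rfl, h'⟩ := mk_eq_mk.mp h
      refine ⟨rfl, ?_⟩
      rw [← hmap]
      refine ⟨_, (J y').inv_mem h', ?_⟩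
      rw [MonoidHom.mem_ker] at hk
      simp [hk]
  · intro x
    obtain ⟨y, w, rfl⟩ := exists_rep x
    obtain ⟨U, hU, hUo, hyU⟩ := eventually_nhds_iff.mp (hJ y)
    refine ⟨_, (isOpen_star hUo y w hU).mem_nhds ⟨y, hyU, 1, one_mem _, by simp⟩, ?_⟩
    rintro ⟨k, hk⟩ ⟨_, ⟨_, ⟨z, hz, j, hj, rfl⟩, rfl⟩, ⟨z', hz', j', hj', h⟩⟩
    change mk J z' (w * j') = mk J z (k * (w * j)) at h
    obtain ⟨rfl, h'⟩ := mk_eq_mk.mp h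
    have h1 : w⁻¹ * k * w ∈ J y := by
      have := (J y).mul_mem ((J y).mul_mem hj' (hU _ hz h')) ((J y).inv_mem hj)
      simpa [mul_assoc] using this
    rw [MonoidHom.mem_ker] at hk
    have h2 := hinj y _ h1 (by simp [hk])
    ext
    simpa [mul_assoc, inv_mul_eq_one, eq_comm] using h2

end BasicConstruction

end BasicConstruction

section Mirrors

variable {n : ℕ} {P : Set (EuclideanSpace ℝ (Fin n))} {W : Type*} [Group W]

/-- The subgroup generated by the elements `lam F` attached to the facets `F` through `p`. -/
def mirrorSubgroup (lam : facets P → W) (p : EuclideanSpace ℝ (Fin n)) : Subgroup W :=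
  Subgroup.closure {g | ∃ F : facets P, p ∈ F.1 ∧ g = lam F}

lemma mem_mirrorSubgroup (lam : facets P → W) {p : EuclideanSpace ℝ (Fin n)} {F : facets P}
    (h : p ∈ F.1) : lam F ∈ mirrorSubgroup lam p :=
  Subgroup.subset_closure ⟨F, h, rfl⟩

lemma mirrorSubgroup_mono (lam : facets P → W) {p q : P} (h : q ∈ openStar P p) :
    mirrorSubgroup lam q ≤ mirrorSubgroup lam p := by
  refine Subgroup.closure_mono ?_
  rintro g ⟨F, hF, rfl⟩
  exact ⟨F, h F.1 F.2 hF, rfl⟩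

lemma IsSimplePolytope.eventually_mirrorSubgroup_le (hP : IsSimplePolytope P) (lam : facets P → W)
    (p : P) : ∀ᶠ q : P in 𝓝 p, mirrorSubgroup lam q ≤ mirrorSubgroup lam p := by
  filter_upwards [(hP.isOpen_openStar p).mem_nhds (mem_openStar_self p)] with q hq
  exact mirrorSubgroup_mono lam hq

lemma map_mirrorSubgroup {G : Type*} [Group G] (lam : facets P → W) (f : W →* G)
    (p : EuclideanSpace ℝ (Fin n)) :
    (mirrorSubgroup lam p).map f = mirrorSubgroup (fun F => f (lam F)) p := by
  rw [mirrorSubgroup, MonoidHom.map_closure]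
  congr 1
  ext g
  constructor
  · rintro ⟨_, ⟨F, hF, rfl⟩, rfl⟩
    exact ⟨F, hF, rfl⟩
  · rintro ⟨F, hF, rfl⟩
    exact ⟨_, ⟨F, hF, rfl⟩, rfl⟩

lemma IsSimplePolytope.contractibleSpace (hP : IsSimplePolytope P) : ContractibleSpace P :=
  hP.convex.contractibleSpace hP.nonempty

/-- The space glued from copies of a polytope is connected if the mirrors generate the group. -/
lemma IsSimplePolytope.pathConnectedSpace_basicConstruction [TopologicalSpace W]
    (hP : IsSimplePolytope P) (lam : facets P → W) (h : Subgroup.closure (range lam) = ⊤) :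
    PathConnectedSpace (BasicConstruction fun p : P => mirrorSubgroup lam p) := by
  have := hP.contractibleSpace
  refine BasicConstruction.pathConnectedSpace (top_unique ?_)
  rw [← h]
  refine Subgroup.closure_mono ?_
  rintro _ ⟨F, rfl⟩
  obtain ⟨p, hp⟩ := F.2.2.1
  exact ⟨⟨p, IsFacet.subset F.2 hp⟩, mem_mirrorSubgroup lam hp⟩

end Mirrors

/-! ### Transport of homotopy classes along paths -/

section Transport

variable {X Y : Type*} [TopologicalSpace X] [TopologicalSpace Y] {x₀ : X}

/-- The homotopy classes of paths starting at `x₀`, with arbitrary endpoint: the set underlying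
the universal cover. -/
abbrev PathClasses (x₀ : X) : Type _ := Σ x : X, Path.Homotopic.Quotient x₀ x

/-- `v` is the class obtained from `u` by appending the path `γ`. -/
def Transport {x y : X} (γ : Path x y) (u v : PathClasses x₀) : Prop :=
  ∃ a : Path.Homotopic.Quotient x₀ x, u = ⟨x, a⟩ ∧
    v = ⟨y, a.trans (Path.Homotopic.Quotient.mk γ)⟩

namespace Transport

variable {x y z x' y' : X} {γ : Path x y} {u v v' : PathClasses x₀}

lemma congr {γ' : Path x' y'} (h : Transport γ u v) (hγ : ∀ t, γ t = γ' t) :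
    Transport γ' u v := by
  obtain rfl : x = x' := by simpa using hγ 0
  obtain rfl : y = y' := by simpa using hγ 1
  obtain rfl : γ = γ' := Path.ext (funext hγ)
  exact h

lemma of_homotopic {γ' : Path x y} (h : Transport γ u v) (hγ : γ.Homotopic γ') :
    Transport γ' u v := by
  obtain ⟨a, rfl, rfl⟩ := h
  exact ⟨a, rfl, by rw [Path.Homotopic.Quotient.eq.mpr hγ]⟩

lemma fst_left (h : Transport γ u v) : u.1 = x := by
  obtain ⟨a, rfl, rfl⟩ := h
  rfl

lemma refl (h : u.1 = x) : Transport (Path.refl x) u u := by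
  obtain ⟨_, a⟩ := u
  obtain rfl := h
  exact ⟨a, rfl, by simp⟩

lemma exists_right (γ : Path x y) (h : u.1 = x) : ∃ v, Transport γ u v := by
  obtain ⟨_, a⟩ := u
  obtain rfl := h
  exact ⟨_, a, rfl, rfl⟩

lemma right_unique (h : Transport γ u v) (h' : Transport γ u v') : v = v' := by
  obtain ⟨a, rfl, rfl⟩ := h
  obtain ⟨b, hb, rfl⟩ := h'
  cases hb
  rfl

lemma symm (h : Transport γ u v) : Transport γ.symm v u := by
  obtain ⟨a, rfl, rfl⟩ := h
  exact ⟨_, rfl, by simp⟩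

lemma trans {δ : Path y z} {w : PathClasses x₀} (h : Transport γ u v) (h' : Transport δ v w) :
    Transport (γ.trans δ) u w := by
  obtain ⟨a, rfl, rfl⟩ := h
  obtain ⟨b, hb, rfl⟩ := h'
  cases hb
  exact ⟨a, rfl, by simp⟩

/-- If the class `u` is transported to `v` by two paths, then the paths are homotopic. -/
lemma homotopic {γ' : Path x y} (h : Transport γ u v) (h' : Transport γ' u v) :
    γ.Homotopic γ' := by
  obtain ⟨a, rfl, rfl⟩ := h
  obtain ⟨b, hb, hv⟩ := h'
  cases hb
  have h1 : a.trans (Path.Homotopic.Quotient.mk γ) = a.trans (Path.Homotopic.Quotient.mk γ') := by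
    simpa using hv
  have h2 := congrArg (fun c => a.symm.trans c) h1
  rw [← Path.Homotopic.Quotient.eq]
  simpa [← Path.Homotopic.Quotient.trans_assoc] using h2

end Transport

/-- `s` is a lift of `c : Y → X` to the classes of paths which is compatible with transport along
all paths of `Y`. -/
def IsFlatLift (c : C(Y, X)) (s : Y → PathClasses x₀) : Prop :=
  ∀ ⦃y y' : Y⦄ (δ : Path y y'), Transport (δ.map c.continuous) (s y) (s y')

namespace IsFlatLift

variable {c c' : C(Y, X)} {s s' : Y → PathClasses x₀}

lemma fst_eq (h : IsFlatLift c s) (y : Y) : (s y).1 = c y :=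
  (h (Path.refl y)).fst_left

lemma eqOn (h : IsFlatLift c s) (h' : IsFlatLift c' s') {A : Set Y} (hA : IsPathConnected A)
    (hc : EqOn c c' A) {y : Y} (hy : y ∈ A) (hs : s y = s' y) : EqOn s s' A := by
  intro z hz
  obtain ⟨δ, hδ⟩ := hA.joinedIn y hy z hz
  refine (h δ).right_unique ?_
  rw [hs]
  exact (h' δ).congr fun t => (hc (hδ t)).symm

lemma ext [PathConnectedSpace Y] (h : IsFlatLift c s) (h' : IsFlatLift c s') {y : Y}
    (hs : s y = s' y) : s = s' :=
  funext fun z => h.eqOn h' (isPathConnected_univ) (fun _ _ => rfl) (mem_univ y) hs (mem_univ z)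

lemma exists_of_simplyConnected [SimplyConnectedSpace Y] (c : C(Y, X)) {y : Y}
    {u : PathClasses x₀} (hu : u.1 = c y) :
    ∃ s : Y → PathClasses x₀, IsFlatLift c s ∧ s y = u := by
  have hex : ∀ z, ∃ v, Transport ((PathConnectedSpace.somePath y z).map c.continuous) u v :=
    fun z => Transport.exists_right _ hu
  choose s hs using hex
  have hs' : ∀ z (δ : Path y z), Transport (δ.map c.continuous) u (s z) := fun z δ =>
    (hs z).of_homotopic ((SimplyConnectedSpace.paths_homotopic _ δ).map c)
  refine ⟨s, fun z z' δ => ?_, ((hs' y (Path.refl y)).right_unique (Transport.refl hu))⟩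
  have h1 := (hs z).symm.trans (hs' z' ((PathConnectedSpace.somePath y z).trans δ))
  refine h1.of_homotopic ?_
  rw [← Path.Homotopic.Quotient.eq]
  rw [Path.map_trans, Path.Homotopic.Quotient.mk_trans, Path.Homotopic.Quotient.mk_trans,
    Path.Homotopic.Quotient.mk_symm, ← Path.Homotopic.Quotient.trans_assoc]
  simp

end IsFlatLift

/-- Let `N` be a simply connected set all of whose points can be reached from a point `x` by a path
in `N` that is compatible with the section `σ`. Then all paths in `N` are compatible with `σ`. -/
lemma transport_of_isSimplyConnected {σ : X → PathClasses x₀} {N : Set X}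
    (hN : IsSimplyConnected N) {x : X}
    (hstar : ∀ y ∈ N, ∃ τ : Path x y, (∀ t, τ t ∈ N) ∧ Transport τ (σ x) (σ y))
    {a b : X} (γ : Path a b) (hγ : ∀ t, γ t ∈ N) : Transport γ (σ a) (σ b) := by
  have := hN.simplyConnectedSpace
  have ha : a ∈ N := by simpa using hγ 0
  have hb : b ∈ N := by simpa using hγ 1
  obtain ⟨α, hα, hαt⟩ := hstar a ha
  obtain ⟨β, hβ, hβt⟩ := hstar b hb
  have hx : x ∈ N := by simpa using hα 0
  have lift : ∀ {p q : X} (hp : p ∈ N) (hq : q ∈ N) (δ : Path p q), (∀ t, δ t ∈ N) →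
      ∃ δ' : Path (⟨p, hp⟩ : N) ⟨q, hq⟩, δ'.map continuous_subtype_val = δ := fun hp hq δ hδ =>
    ⟨{ toFun := fun t => ⟨δ t, hδ t⟩, source' := by simp, target' := by simp }, by ext; rfl⟩
  obtain ⟨α', rfl⟩ := lift hx ha α hα
  obtain ⟨β', rfl⟩ := lift hx hb β hβ
  obtain ⟨γ', rfl⟩ := lift ha hb γ hγ
  refine (hαt.symm.trans hβt).of_homotopic ?_
  have h := (SimplyConnectedSpace.paths_homotopic (α'.symm.trans β') γ').map
    ⟨Subtype.val, continuous_subtype_val⟩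
  rw [Path.map_trans] at h
  exact h

/-- A section that is compatible with all small paths is compatible with all paths, by subdivision
of the interval. -/
lemma transport_of_locally {σ : X → PathClasses x₀} (hσ : ∀ x, (σ x).1 = x)
    (hloc : ∀ x, ∃ N : Set X, IsOpen N ∧ x ∈ N ∧
      ∀ ⦃a b : X⦄ (γ : Path a b), (∀ t, γ t ∈ N) → Transport γ (σ a) (σ b))
    {a b : X} (γ : Path a b) : Transport γ (σ a) (σ b) := by
  choose N hNo hxN hN using hloc
  obtain ⟨t, ht0, htm, ⟨m, hm⟩, hsub⟩ := exists_monotone_Icc_subset_open_cover_unitInterval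
    (c := fun x => γ ⁻¹' N x) (fun x => (hNo x).preimage γ.continuous)
    (fun s _ => mem_iUnion.mpr ⟨γ s, hxN _⟩)
  have key : ∀ k, Transport (γ.subpath 0 (t k)) (σ (γ 0)) (σ (γ (t k))) := by
    intro k
    induction k with
    | zero =>
      rw [ht0]
      rw [Path.subpath_self]
      exact Transport.refl (hσ _)
    | succ k ih =>
      obtain ⟨x, hx⟩ := hsub k
      have h1 : Transport (γ.subpath (t k) (t (k + 1))) (σ (γ (t k))) (σ (γ (t (k + 1)))) := by
        refine hN x _ fun s => ?_
        have h2 : γ.subpath (t k) (t (k + 1)) s ∈ range (γ.subpath (t k) (t (k + 1))) :=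
          mem_range_self s
        rw [Path.range_subpath_of_le _ _ _ (htm k.le_succ)] at h2
        obtain ⟨r, hr, hrs⟩ := h2
        rw [← hrs]
        exact hx hr
      exact (ih.trans h1).of_homotopic ⟨Path.Homotopy.subpathTransSubpath γ _ _ _⟩
  have h := key m
  rw [hm m le_rfl] at h
  have h' : Transport γ (σ (γ 0)) (σ (γ 1)) := h.congr fun s => by simp
  rwa [γ.source, γ.target] at h'

/-- A path connected space is simply connected if there is a section of its path classes which is
compatible with transport along all paths. -/
lemma simplyConnectedSpace_of_transport [PathConnectedSpace X] {σ : X → PathClasses x₀}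
    (h : ∀ ⦃a b : X⦄ (γ : Path a b), Transport γ (σ a) (σ b)) : SimplyConnectedSpace X :=
  simply_connected_iff_paths_homotopic'.mpr ⟨inferInstance, fun γ γ' => (h γ).homotopic (h γ')⟩

end Transport

/-! ### Elementary abelian 2-groups -/

section Z2Power

variable {ι : Type*}

lemma Z2Power.mul_self (g : Z2Power ι) : g * g = 1 := by
  refine Multiplicative.toAdd.injective ?_
  funext i
  exact CharTwo.add_self_eq_zero (Multiplicative.toAdd g i)

lemma Z2Power.card_eq (ι : Type*) [Finite ι] : Nat.card (Z2Power ι) = 2 ^ Nat.card ι := by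
  change Nat.card (ι → ZMod 2) = _
  rw [Nat.card_fun, Nat.card_zmod]

lemma Z2Power.closure_single [Finite ι] [DecidableEq ι] :
    Subgroup.closure
      (range fun i : ι => (Multiplicative.ofAdd (Pi.single i 1) : Z2Power ι)) = ⊤ := by
  have := Fintype.ofFinite ι
  refine top_unique fun g _ => ?_
  have hg : g =
      ∏ i, (Multiplicative.ofAdd (Pi.single i (Multiplicative.toAdd g i)) : Z2Power ι) := by
    refine Multiplicative.toAdd.injective ?_
    rw [toAdd_prod]
    exact (Finset.univ_sum_single (Multiplicative.toAdd g)).symm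
  rw [hg]
  refine Subgroup.prod_mem _ fun i _ => ?_
  have h2 : ∀ a : ZMod 2, a = 0 ∨ a = 1 := by decide
  rcases h2 (Multiplicative.toAdd g i) with h | h
  · rw [h, Pi.single_zero]
    exact one_mem _
  · rw [h]
    exact Subgroup.subset_closure ⟨i, rfl⟩

/-- Universal property of `(ℤ/2)^ι`: commuting involutions `T i` define a homomorphism. -/
lemma Z2Power.exists_monoidHom [Finite ι] [DecidableEq ι] {M : Type*} [Group M] (T : ι → M)
    (hT : ∀ i, T i * T i = 1) (hc : ∀ i j, Commute (T i) (T j)) :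
    ∃ Φ : Z2Power ι →* M, ∀ i, Φ (Multiplicative.ofAdd (Pi.single i 1)) = T i := by
  have := Fintype.ofFinite ι
  let φ : ∀ _ : ι, Multiplicative (ZMod 2) →* M := fun i =>
    { toFun := fun a => T i ^ (Multiplicative.toAdd a).val
      map_one' := by simp
      map_mul' := fun a b => by
        rw [← pow_add, toAdd_mul, ZMod.val_add]
        exact (pow_eq_pow_mod _ (by rw [pow_two, hT])).symm }
  have hcomm : Pairwise fun i j => ∀ x y, Commute (φ i x) (φ j y) := fun i j _ x y =>
    (hc i j).pow_pow _ _
  let Φ := MonoidHom.noncommPiCoprod φ hcomm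
  refine ⟨{ toFun := fun g => Φ fun i => Multiplicative.ofAdd (Multiplicative.toAdd g i)
            map_one' := map_one Φ
            map_mul' := fun a b => map_mul Φ _ _ }, fun i => ?_⟩
  have h1 : (fun j => Multiplicative.ofAdd ((Pi.single i 1 : ι → ZMod 2) j)) =
      (Pi.mulSingle i (Multiplicative.ofAdd 1) : ι → Multiplicative (ZMod 2)) := by
    funext j
    by_cases h : j = i
    · subst h; simp
    · simp [h]
  change Φ (fun j => Multiplicative.ofAdd ((Pi.single i 1 : ι → ZMod 2) j)) = T i
  rw [h1, MonoidHom.noncommPiCoprod_mulSingle]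
  change T i ^ (1 : ZMod 2).val = T i
  rw [ZMod.val_one, pow_one]

end Z2Power

section FacetVector

variable {n : ℕ} {P : Set (EuclideanSpace ℝ (Fin n))}

lemma closure_facetVector (h : Finite (facets P)) :
    Subgroup.closure (range (facetVector P)) = ⊤ := by
  classical
  rw [← Z2Power.closure_single (ι := facets P)]
  congr! 2

lemma exists_monoidHom_facetVector (h : Finite (facets P)) {M : Type*} [Group M]
    (T : facets P → M) (hT : ∀ F, T F * T F = 1) (hc : ∀ F G, Commute (T F) (T G)) :
    ∃ Φ : Z2Power (facets P) →* M, ∀ F, Φ (facetVector P F) = T F := by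
  classical
  obtain ⟨Φ, hΦ⟩ := Z2Power.exists_monoidHom T hT hc
  refine ⟨Φ, fun F => ?_⟩
  rw [← hΦ F]
  unfold facetVector
  congr!

end FacetVector

/-! ### Real moment-angle manifolds of 2-neighborly polytopes -/

section TwoNeighborly

variable {n : ℕ} {P : Set (EuclideanSpace ℝ (Fin n))}

/-- The inclusion of the chamber `w` into the real moment-angle manifold. -/
def chamber (P : Set (EuclideanSpace ℝ (Fin n))) (w : Z2Power (facets P)) :
    C(P, RealMomentAngle P) :=
  ⟨fun p => BasicConstruction.mk (fun p : P => faceSubgroup P p) p w,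
    BasicConstruction.continuous_mk w⟩

lemma exists_chamber_eq (x : RealMomentAngle P) : ∃ p w, chamber P w p = x :=
  BasicConstruction.exists_rep (J := fun p : P => faceSubgroup P p) x

lemma chamber_eq_of_mem {p : P} {w j : Z2Power (facets P)} (hj : j ∈ faceSubgroup P p) :
    chamber P (w * j) p = chamber P w p :=
  BasicConstruction.mk_mul hj

lemma facetVector_mem {p : P} {F : facets P} (h : p.1 ∈ F.1) :
    facetVector P F ∈ faceSubgroup P p :=
  Subgroup.subset_closure ⟨F, h, rfl⟩

/-- A lift of one of the chambers of `ℝ𝒵_P` to the classes of paths from `x₀`. -/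
structure ChamberLift (x₀ : RealMomentAngle P) where
  /-- The index of the lifted chamber. -/
  index : Z2Power (facets P)
  /-- The lift. -/
  lift : P → PathClasses x₀
  isFlatLift : IsFlatLift (chamber P index) lift

namespace ChamberLift

variable {x₀ : RealMomentAngle P}

lemma ext_of_apply (hP : IsSimplePolytope P) {l l' : ChamberLift x₀} (hi : l.index = l'.index)
    {p : P} (h : l.lift p = l'.lift p) : l = l' := by
  have := hP.contractibleSpace
  obtain ⟨i, s, hs⟩ := l
  obtain ⟨i', s', hs'⟩ := l'
  obtain rfl : i = i' := hi
  obtain rfl : s = s' := hs.ext hs' h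
  rfl

/-- Two chambers adjacent along the facet `F` coincide on `F`, so that a lift of the one determines
a lift of the other which agrees with it along `F`. -/
lemma exists_reflection (hP : IsSimplePolytope P) (F : facets P) (l : ChamberLift x₀) :
    ∃ l' : ChamberLift x₀, l'.index = l.index * facetVector P F ∧
      ∀ p : P, p.1 ∈ F.1 → l'.lift p = l.lift p := by
  have := hP.contractibleSpace
  have hF : IsFacet P F.1 := F.2
  obtain ⟨p, hp⟩ := hF.2.1
  let p' : P := ⟨p, hF.subset hp⟩
  have hbase : (l.lift p').1 = chamber P (l.index * facetVector P F) p' := by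
    rw [l.isFlatLift.fst_eq, chamber_eq_of_mem (facetVector_mem hp)]
  obtain ⟨s, hs, hsp⟩ := IsFlatLift.exists_of_simplyConnected _ hbase
  refine ⟨⟨_, s, hs⟩, rfl, fun q hq => ?_⟩
  have hA : IsPathConnected {q : P | q.1 ∈ F.1} := by
    have h1 : IsPathConnected F.1 := (hF.convex hP.convex).isPathConnected hF.2.1
    refine Topology.IsInducing.subtypeVal.isPathConnected_iff.mpr ?_
    convert h1
    ext q
    exact ⟨fun ⟨r, hr, hrq⟩ => hrq ▸ hr, fun hq => ⟨⟨q, hF.subset hq⟩, hq, rfl⟩⟩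
  refine hs.eqOn l.isFlatLift hA ?_ (y := p') hp hsp hq
  intro r hr
  exact chamber_eq_of_mem (facetVector_mem hr)

/-- The lift of the chamber on the other side of the facet `F`. -/
noncomputable def reflection (hP : IsSimplePolytope P) (F : facets P) (l : ChamberLift x₀) :
    ChamberLift x₀ :=
  (exists_reflection hP F l).choose

lemma index_reflection (hP : IsSimplePolytope P) (F : facets P) (l : ChamberLift x₀) :
    (reflection hP F l).index = l.index * facetVector P F :=
  (exists_reflection hP F l).choose_spec.1

lemma reflection_lift (hP : IsSimplePolytope P) (F : facets P) (l : ChamberLift x₀) {p : P}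
    (hp : p.1 ∈ F.1) : (reflection hP F l).lift p = l.lift p :=
  (exists_reflection hP F l).choose_spec.2 p hp

lemma reflection_involutive (hP : IsSimplePolytope P) (F : facets P) :
    Function.Involutive (reflection hP F : ChamberLift x₀ → ChamberLift x₀) := by
  intro l
  obtain ⟨p, hp⟩ := F.2.2.1
  refine ext_of_apply hP (p := ⟨p, IsFacet.subset F.2 hp⟩) ?_ ?_
  · rw [index_reflection, index_reflection, mul_assoc, Z2Power.mul_self, mul_one]
  · rw [reflection_lift hP F _ hp, reflection_lift hP F _ hp]

/-- Reflections in intersecting facets commute, since at a common point of the facets both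
compositions agree with the original lift. -/
lemma reflection_comm (hP : IsSimplePolytope P) {F G : facets P} (h : (F.1 ∩ G.1).Nonempty)
    (l : ChamberLift x₀) :
    reflection hP F (reflection hP G l) = reflection hP G (reflection hP F l) := by
  obtain ⟨p, hpF, hpG⟩ := h
  refine ext_of_apply hP (p := ⟨p, IsFacet.subset F.2 hpF⟩) ?_ ?_
  · simp only [index_reflection, mul_assoc, mul_comm (facetVector P F)]
  · rw [reflection_lift hP F _ hpF, reflection_lift hP G _ hpG, reflection_lift hP G _ hpG,
      reflection_lift hP F _ hpF]

/-- If any two facets intersect, then the reflections define an action of `(ℤ/2)^r` on the lifts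
of chambers. -/
lemma exists_action (hP : IsSimplePolytope P) (hN : IsTwoNeighborly P) (x₀ : RealMomentAngle P) :
    ∃ Φ : Z2Power (facets P) →* Equiv.Perm (ChamberLift x₀),
      (∀ g l, (Φ g l).index = l.index * g) ∧
      ∀ (p : P), ∀ j ∈ faceSubgroup P p, ∀ l, (Φ j l).lift p = l.lift p := by
  have hfin := hP.finite_facets_coe
  obtain ⟨Φ, hΦ⟩ := exists_monoidHom_facetVector hfin
    (fun F => (reflection_involutive (x₀ := x₀) hP F).toPerm)
    (fun F => Equiv.ext fun l => reflection_involutive hP F l)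
    (fun F G => Equiv.ext fun l => by
      by_cases hFG : F = G
      · rw [hFG]
      · exact reflection_comm hP (hN F.1 F.2 G.1 G.2 fun h => hFG (Subtype.ext h)) l)
  refine ⟨Φ, ?_, ?_⟩
  · intro g
    have hg : g ∈ Subgroup.closure (range (facetVector P)) := by
      rw [closure_facetVector hfin]; trivial
    induction hg using Subgroup.closure_induction with
    | mem g hg =>
      obtain ⟨F, rfl⟩ := hg
      intro l
      rw [hΦ]
      exact index_reflection hP F l
    | one => simp
    | mul a b _ _ iha ihb =>
      intro l
      rw [map_mul, Equiv.Perm.mul_apply, iha, ihb, mul_assoc, mul_comm b]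
    | inv a _ iha =>
      intro l
      have := iha (Φ a⁻¹ l)
      rw [← Equiv.Perm.mul_apply, ← map_mul, mul_inv_cancel, map_one, Equiv.Perm.one_apply] at this
      rw [this, mul_inv_cancel_right]
  · intro p g hg
    induction hg using Subgroup.closure_induction with
    | mem g hg =>
      obtain ⟨F, hF, rfl⟩ := hg
      intro l
      rw [hΦ]
      exact reflection_lift hP F l hF
    | one => simp
    | mul a b _ _ iha ihb =>
      intro l
      rw [map_mul, Equiv.Perm.mul_apply, iha, ihb]
    | inv a _ iha =>
      intro l
      have := iha (Φ a⁻¹ l)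
      rw [← Equiv.Perm.mul_apply, ← map_mul, mul_inv_cancel, map_one, Equiv.Perm.one_apply] at this
      exact this.symm

end ChamberLift

/-- The lifts of the chambers in an orbit of `(ℤ/2)^r` fit together to a section. -/
lemma exists_section (hP : IsSimplePolytope P) (hN : IsTwoNeighborly P) :
    ∃ (x₀ : RealMomentAngle P) (σ : RealMomentAngle P → PathClasses x₀),
      ∀ w, IsFlatLift (chamber P w) fun p => σ (chamber P w p) := by
  have := hP.contractibleSpace
  obtain ⟨p₀, hp₀⟩ := hP.nonempty
  let x₀ := chamber P 1 ⟨p₀, hp₀⟩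
  obtain ⟨s, hs, -⟩ := IsFlatLift.exists_of_simplyConnected (chamber P 1) (y := ⟨p₀, hp₀⟩)
    (u := (⟨x₀, .refl x₀⟩ : PathClasses x₀)) rfl
  obtain ⟨Φ, hΦi, hΦl⟩ := ChamberLift.exists_action hP hN x₀
  let l₀ : ChamberLift x₀ := ⟨1, s, hs⟩
  refine ⟨x₀, Quotient.lift (fun a => (Φ a.2 l₀).lift a.1) ?_, fun w => ?_⟩
  · rintro ⟨p, w⟩ ⟨q, v⟩ ⟨h, hj⟩
    obtain rfl : p = q := h
    change (Φ w l₀).lift p = (Φ v l₀).lift p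
    have hv : v = (w⁻¹ * v) * w := by rw [mul_comm w⁻¹, inv_mul_cancel_right]
    rw [hv, map_mul, Equiv.Perm.mul_apply, hΦl p _ hj]
  · have h := (Φ w l₀).isFlatLift
    rw [hΦi, show l₀.index = 1 from rfl, one_mul] at h
    exact h

lemma faceSubgroup_mono {p q : P} (h : ∀ F ∈ facets P, q.1 ∈ F → p.1 ∈ F) :
    faceSubgroup P q ≤ faceSubgroup P p :=
  mirrorSubgroup_mono (facetVector P) h

/-- The point at time `t` on the segment from `p` to `q`. -/
noncomputable def segmentPoint (hP : Convex ℝ P) (p q : P) (t : unitInterval) : P :=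
  ⟨AffineMap.lineMap p.1 q.1 (t : ℝ), hP.lineMap_mem p.2 q.2 t.2⟩

lemma continuous_segmentPoint (hP : Convex ℝ P) (p : P) :
    Continuous fun a : P × unitInterval => segmentPoint hP p a.1 a.2 := by
  refine Continuous.subtype_mk ?_ _
  simp only [AffineMap.lineMap_apply_module]
  fun_prop

lemma continuous_segmentPoint_right (hP : Convex ℝ P) (p q : P) :
    Continuous fun t : unitInterval => segmentPoint hP p q t := by
  refine Continuous.subtype_mk ?_ _
  simp only [AffineMap.lineMap_apply_module]
  fun_prop

lemma segmentPoint_zero (hP : Convex ℝ P) (p q : P) : segmentPoint hP p q 0 = p := by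
  ext1; simp [segmentPoint]

lemma segmentPoint_one (hP : Convex ℝ P) (p q : P) : segmentPoint hP p q 1 = q := by
  ext1; simp [segmentPoint]

/-- The segment from `p` to `q` as a path in `P`. -/
noncomputable def segmentPath (hP : Convex ℝ P) (p q : P) : Path p q where
  toFun := fun t => segmentPoint hP p q t
  continuous_toFun := continuous_segmentPoint_right hP p q
  source' := segmentPoint_zero _ _ _
  target' := segmentPoint_one _ _ _

lemma mem_facet_segmentPoint (hP : Convex ℝ P) {p q : P} {F : Set (EuclideanSpace ℝ (Fin n))}
    (hF : IsFacet P F) (hp : p.1 ∈ F) (hq : q.1 ∈ F) (t : unitInterval) :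
    (segmentPoint hP p q t).1 ∈ F :=
  (hF.convex hP).lineMap_mem hp hq t.2

/-- The open star is star-shaped since facets are extreme subsets. -/
lemma segmentPoint_mem_openStar (hP : Convex ℝ P) {p q : P} (hq : q ∈ openStar P p)
    (t : unitInterval) : segmentPoint hP p q t ∈ openStar P p := by
  intro F hF hmem
  by_cases h0 : t = 0
  · rwa [h0, segmentPoint_zero] at hmem
  by_cases h1 : t = 1
  · rw [h1, segmentPoint_one] at hmem
    exact hq F hF hmem
  · have ht : (segmentPoint hP p q t).1 ∈ openSegment ℝ p.1 q.1 := by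
      rw [openSegment_eq_image_lineMap]
      exact ⟨t, ⟨unitInterval.pos_iff_ne_zero.mpr h0, unitInterval.lt_one_iff_ne_one.mpr h1⟩, rfl⟩
    exact (IsFacet.openSegment_mem hF p.2 q.2 ht hmem).1

/-- The star of the point `p` of the chamber `w` in `ℝ𝒵_P`. -/
def starNhd (p : P) (w : Z2Power (facets P)) : Set (RealMomentAngle P) :=
  BasicConstruction.star (fun p : P => faceSubgroup P p) (openStar P p) p w

lemma isOpen_starNhd (hP : IsSimplePolytope P) (p : P) (w : Z2Power (facets P)) :
    IsOpen (starNhd p w) := by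
  have := hP.finite_facets_coe
  exact BasicConstruction.isOpen_star (hP.isOpen_openStar p) p w fun z hz => faceSubgroup_mono hz

lemma mem_starNhd (p : P) (w : Z2Power (facets P)) : chamber P w p ∈ starNhd p w :=
  ⟨p, mem_openStar_self p, 1, one_mem _, by rw [mul_one]; rfl⟩

/-- The star of a point contracts to that point along segments. -/
lemma isSimplyConnected_starNhd (hP : IsSimplePolytope P) (p : P) (w : Z2Power (facets P)) :
    IsSimplyConnected (starNhd p w) := by
  have := hP.finite_facets_coe
  have hcontr : ContractibleSpace (starNhd p w) :=
    BasicConstruction.contractibleSpace_star (hP.isOpen_openStar p) (mem_openStar_self p) w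
      (fun z hz => faceSubgroup_mono hz) (continuous_segmentPoint hP.convex p)
      (fun z _ => segmentPoint_zero hP.convex p z) (fun z _ => segmentPoint_one hP.convex p z)
      (fun z hz t => segmentPoint_mem_openStar hP.convex hz t)
      (fun z hz t => faceSubgroup_mono fun F hF hzF =>
        mem_facet_segmentPoint hP.convex hF (hz F hF hzF) hzF t)
  exact (inferInstance : SimplyConnectedSpace (starNhd p w))

/-- The points of the star of a point `p` are joined to `p` by segments inside a chamber, along
which the section is flat. -/
lemma exists_transport_starNhd (hP : IsSimplePolytope P) {x₀ : RealMomentAngle P}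
    {σ : RealMomentAngle P → PathClasses x₀}
    (hσ : ∀ w, IsFlatLift (chamber P w) fun p => σ (chamber P w p)) (p : P)
    (w : Z2Power (facets P)) (y : RealMomentAngle P) (hy : y ∈ starNhd p w) :
    ∃ τ : Path (chamber P w p) y, (∀ t, τ t ∈ starNhd p w) ∧
      Transport τ (σ (chamber P w p)) (σ y) := by
  obtain ⟨q, hq, j, hj, hy⟩ := hy
  obtain rfl : chamber P (w * j) q = y := hy
  have hpj : chamber P w p = chamber P (w * j) p := (chamber_eq_of_mem hj).symm
  rw [hpj]
  refine ⟨(segmentPath hP.convex p q).map (chamber P (w * j)).continuous, fun t => ?_,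
    hσ (w * j) (segmentPath hP.convex p q)⟩
  exact ⟨_, segmentPoint_mem_openStar hP.convex hq t, j, hj, rfl⟩

theorem IsTwoNeighborly.simplyConnectedSpace (hP : IsSimplePolytope P) (hN : IsTwoNeighborly P) :
    SimplyConnectedSpace (RealMomentAngle P) := by
  have hfin := hP.finite_facets_coe
  have : PathConnectedSpace (RealMomentAngle P) :=
    hP.pathConnectedSpace_basicConstruction (facetVector P) (closure_facetVector hfin)
  obtain ⟨x₀, σ, hσ⟩ := exists_section hP hN
  have hbase : ∀ x, (σ x).1 = x := by
    intro x
    obtain ⟨p, w, rfl⟩ := exists_chamber_eq x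
    exact (hσ w).fst_eq p
  have hloc : ∀ x, ∃ N : Set (RealMomentAngle P), IsOpen N ∧ x ∈ N ∧
      ∀ ⦃a b⦄ (γ : Path a b), (∀ t, γ t ∈ N) → Transport γ (σ a) (σ b) := by
    intro x
    obtain ⟨p, w, rfl⟩ := exists_chamber_eq x
    exact ⟨starNhd p w, isOpen_starNhd hP p w, mem_starNhd p w, fun a b γ hγ =>
      transport_of_isSimplyConnected (isSimplyConnected_starNhd hP p w)
        (exists_transport_starNhd hP hσ p w) γ hγ⟩
  exact simplyConnectedSpace_of_transport fun a b γ => transport_of_locally hbase hloc γ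

end TwoNeighborly

/-! ### A central extension of an elementary abelian 2-group -/

section CentralExtension

/-- The central extension of `(ℤ/2)^ι` by `ℤ/2` with cocycle `(x, y) ↦ x a * y b`: the lifts of all
pairs of basis vectors commute, except for those with the indices `a` and `b`. -/
@[ext]
structure CentralExtension {ι : Type*} (a b : ι) where
  /-- The image in `(ℤ/2)^ι`. -/
  vec : ι → ZMod 2
  /-- The central coordinate. -/
  cen : ZMod 2

namespace CentralExtension

variable {ι : Type*} {a b : ι}

instance : Group (CentralExtension a b) where
  mul x y := ⟨x.vec + y.vec, x.cen + y.cen + x.vec a * y.vec b⟩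
  one := ⟨0, 0⟩
  inv x := ⟨-x.vec, -x.cen + x.vec a * x.vec b⟩
  mul_assoc x y z := by
    refine CentralExtension.ext (add_assoc _ _ _) ?_
    change x.cen + y.cen + x.vec a * y.vec b + z.cen + (x.vec a + y.vec a) * z.vec b =
      x.cen + (y.cen + z.cen + y.vec a * z.vec b) + x.vec a * (y.vec b + z.vec b)
    ring
  one_mul x := by
    refine CentralExtension.ext (zero_add _) ?_
    change 0 + x.cen + 0 * x.vec b = x.cen
    ring
  mul_one x := by
    refine CentralExtension.ext (add_zero _) ?_
    change x.cen + 0 + x.vec a * 0 = x.cen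
    ring
  inv_mul_cancel x := by
    refine CentralExtension.ext (neg_add_cancel _) ?_
    change -x.cen + x.vec a * x.vec b + x.cen + -x.vec a * x.vec b = 0
    ring

lemma vec_mul (x y : CentralExtension a b) : (x * y).vec = x.vec + y.vec := rfl

lemma cen_mul (x y : CentralExtension a b) :
    (x * y).cen = x.cen + y.cen + x.vec a * y.vec b := rfl

lemma vec_inv (x : CentralExtension a b) : x⁻¹.vec = -x.vec := rfl

lemma cen_inv (x : CentralExtension a b) : x⁻¹.cen = -x.cen + x.vec a * x.vec b := rfl

instance : TopologicalSpace (CentralExtension a b) := ⊥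

instance : DiscreteTopology (CentralExtension a b) := ⟨rfl⟩

/-- The set underlying the central extension is a product. -/
def equivProd (a b : ι) : CentralExtension a b ≃ (ι → ZMod 2) × ZMod 2 where
  toFun x := (x.vec, x.cen)
  invFun x := ⟨x.1, x.2⟩
  left_inv _ := rfl
  right_inv _ := rfl

lemma card_eq [Finite ι] : Nat.card (CentralExtension a b) = 2 ^ (Nat.card ι + 1) := by
  rw [Nat.card_congr (equivProd a b), Nat.card_prod, Nat.card_fun]
  simp [pow_succ]

instance [Finite ι] : Finite (CentralExtension a b) := Finite.of_equiv _ (equivProd a b).symm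

/-- The projection to the elementary abelian group. -/
def proj (a b : ι) : CentralExtension a b →* Z2Power ι where
  toFun x := Multiplicative.ofAdd x.vec
  map_one' := rfl
  map_mul' _ _ := rfl

lemma proj_surjective : Function.Surjective (proj a b) := fun g =>
  ⟨⟨Multiplicative.toAdd g, 0⟩, rfl⟩

variable [DecidableEq ι]

/-- The lift of a basis vector. -/
def gen (a b i : ι) : CentralExtension a b := ⟨Pi.single i 1, 0⟩

lemma proj_gen (i : ι) : proj a b (gen a b i) = Multiplicative.ofAdd (Pi.single i 1) := rfl

/-- The generator of the kernel of the projection is the commutator of the lifts of the basis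
vectors with the indices `a` and `b`. -/
lemma closure_gen [Finite ι] (hab : a ≠ b) : Subgroup.closure (range (gen a b)) = ⊤ := by
  have hgen : ∀ i, gen a b i ∈ Subgroup.closure (range (gen a b)) := fun i =>
    Subgroup.subset_closure ⟨i, rfl⟩
  have hcomm : (⟨0, 1⟩ : CentralExtension a b) =
      gen a b a * gen a b b * (gen a b b * gen a b a)⁻¹ := by
    ext i
    · simp only [vec_mul, vec_inv, gen, Pi.add_apply, Pi.neg_apply, Pi.zero_apply]
      ring
    · simp [cen_mul, cen_inv, vec_mul, vec_inv, gen, hab, hab.symm]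
      rfl
  have hz : (⟨0, 1⟩ : CentralExtension a b) ∈ Subgroup.closure (range (gen a b)) := by
    rw [hcomm]
    exact Subgroup.mul_mem _ (Subgroup.mul_mem _ (hgen a) (hgen b))
      (Subgroup.inv_mem _ (Subgroup.mul_mem _ (hgen b) (hgen a)))
  refine top_unique fun x _ => ?_
  have hmap : (Subgroup.closure (range (gen a b))).map (proj a b) = ⊤ := by
    rw [MonoidHom.map_closure, ← range_comp, ← Z2Power.closure_single (ι := ι)]
    rfl
  obtain ⟨y, hy, hyx⟩ : proj a b x ∈ (Subgroup.closure (range (gen a b))).map (proj a b) := by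
    rw [hmap]; trivial
  have hvec : y.vec = x.vec := congrArg Multiplicative.toAdd hyx
  have hxy : x = ⟨0, x.cen - y.cen⟩ * y := by
    ext i
    · simp [vec_mul, hvec]
    · simp [cen_mul]
  rw [hxy]
  refine Subgroup.mul_mem _ ?_ hy
  have h2 : ∀ c : ZMod 2, c = 0 ∨ c = 1 := by decide
  rcases h2 (x.cen - y.cen) with h | h
  · rw [h]
    exact Subgroup.one_mem _
  · rw [h]
    exact hz

/-- A set of lifts of basis vectors whose index set does not contain both `a` and `b` generates a
subgroup which maps injectively to the elementary abelian group, since the cocycle vanishes. -/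
lemma eq_one_of_mem_closure {S : Set ι} (hS : a ∉ S ∨ b ∉ S) {x : CentralExtension a b}
    (hx : x ∈ Subgroup.closure (gen a b '' S)) (h : proj a b x = 1) : x = 1 := by
  have hvec : x.vec = 0 := congrArg Multiplicative.toAdd h
  suffices hcen : x.cen = 0 from CentralExtension.ext hvec hcen
  suffices H : (x.vec a = 0 ∨ x.vec b = 0) ∧ x.cen = 0 from H.2
  rcases hS with hS | hS
  · suffices H : x.vec a = 0 ∧ x.cen = 0 from ⟨Or.inl H.1, H.2⟩
    clear h hvec
    induction hx using Subgroup.closure_induction with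
    | mem x hx =>
      obtain ⟨i, hi, rfl⟩ := hx
      have hia : a ≠ i := fun h => hS (h ▸ hi)
      simp [gen, hia]
    | one => exact ⟨rfl, rfl⟩
    | mul x y _ _ hx hy => simp [vec_mul, cen_mul, hx, hy]
    | inv x _ hx => simp [vec_inv, cen_inv, hx]
  · suffices H : x.vec b = 0 ∧ x.cen = 0 from ⟨Or.inr H.1, H.2⟩
    clear h hvec
    induction hx using Subgroup.closure_induction with
    | mem x hx =>
      obtain ⟨i, hi, rfl⟩ := hx
      have hib : b ≠ i := fun h => hS (h ▸ hi)
      simp [gen, hib]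
    | one => exact ⟨rfl, rfl⟩
    | mul x y _ _ hx hy => simp [vec_mul, cen_mul, hx, hy]
    | inv x _ hx => simp [vec_inv, cen_inv, hx]

end CentralExtension

end CentralExtension

/-! ### Fundamental groups of quotients of the real moment-angle manifold -/

section Quotients

variable {n : ℕ} {P : Set (EuclideanSpace ℝ (Fin n))} {G X : Type*} [Group G] [TopologicalSpace G]
  [DiscreteTopology G] [TopologicalSpace X] {φ : Z2Power (facets P) →* G} {Ψ : P × G → X}

/-- `X` is obtained by gluing chambers of `P` indexed by `G` by means of a surjection
`φ : (ℤ/2)^r → G` which is injective on the isotropy groups, so that `ℝ𝒵_P` is a covering of `X`. -/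
structure IsMomentAngleQuotient (φ : Z2Power (facets P) →* G) (Ψ : P × G → X) : Prop where
  surjective : Function.Surjective φ
  injOn : ∀ p : P, ∀ j ∈ faceSubgroup P p, φ j = 1 → j = 1
  isQuotientMap : IsQuotientMap Ψ
  apply_eq_iff : ∀ a b, Ψ a = Ψ b ↔ a.1 = b.1 ∧ a.2⁻¹ * b.2 ∈ (faceSubgroup P a.1).map φ

lemma isMomentAngleQuotient_realMomentAngle :
    IsMomentAngleQuotient (MonoidHom.id (Z2Power (facets P)))
      (Quotient.mk (realMomentAngleSetoid P)) where
  surjective := Function.surjective_id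
  injOn _ _ _ h := h
  isQuotientMap := isQuotientMap_quotient_mk'
  apply_eq_iff a b := by
    rw [Subgroup.map_id]
    exact Quotient.eq

/-- If `ℝ𝒵_P` is the universal covering of `X`, then its group of deck transformations is the
fundamental group of `X`. -/
lemma IsMomentAngleQuotient.nonempty_mulEquiv (h : IsMomentAngleQuotient φ Ψ)
    (hP : IsSimplePolytope P) (hN : IsTwoNeighborly P) (x : X) :
    Nonempty (FundamentalGroup X x ≃* φ.kerᵐᵒᵖ) := by
  have := hP.finite_facets_coe
  have : SimplyConnectedSpace (BasicConstruction fun p : P => mirrorSubgroup (facetVector P) p) :=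
    hN.simplyConnectedSpace hP
  obtain ⟨π, hπ⟩ := BasicConstruction.exists_isQuotientCoveringMap h.surjective
    (hP.eventually_mirrorSubgroup_le (facetVector P)) (fun _ => rfl) h.injOn h.isQuotientMap
    h.apply_eq_iff
  obtain ⟨e, he⟩ := hπ.surjective x
  exact ⟨hπ.fundamentalGroupEquiv ⟨e, he⟩⟩

/-- If the facets `F` and `F'` are disjoint, then the basic construction of the central extension
in which the lifts of their basis vectors do not commute is a connected double covering of `ℝ𝒵_P`,
hence a connected covering of `X` with a group `K` of order `2 ^ (r + 1) / |G|`. -/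
lemma IsMomentAngleQuotient.exists_surjective (h : IsMomentAngleQuotient φ Ψ)
    (hP : IsSimplePolytope P) (hN : ¬ IsTwoNeighborly P) (x : X) :
    ∃ (K : Type) (_ : Group K) (f : FundamentalGroup X x → K),
      Function.Surjective f ∧ Nat.card K * Nat.card G = 2 ^ ((facets P).ncard + 1) := by
  classical
  have hfin := hP.finite_facets_coe
  simp only [IsTwoNeighborly, not_forall] at hN
  obtain ⟨F, hF, F', hF', hne, hdisj⟩ := hN
  rw [not_nonempty_iff_eq_empty] at hdisj
  let a : facets P := ⟨F, hF⟩
  let b : facets P := ⟨F', hF'⟩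
  have hab : a ≠ b := fun h => hne (congrArg Subtype.val h)
  let lam : facets P → CentralExtension a b := CentralExtension.gen a b
  let f : CentralExtension a b →* G := φ.comp (CentralExtension.proj a b)
  have hlam : ∀ i, CentralExtension.proj a b (lam i) = facetVector P i := fun i => by
    unfold facetVector
    rw [CentralExtension.proj_gen]
  have hproj : ∀ p : P, (mirrorSubgroup lam p).map (CentralExtension.proj a b) =
      faceSubgroup P p := fun p => by
    rw [map_mirrorSubgroup]
    simp only [hlam]
    rfl
  have hf : Function.Surjective f := h.surjective.comp CentralExtension.proj_surjective
  have hmap : ∀ p : P, (mirrorSubgroup lam p).map f = (faceSubgroup P p).map φ := fun p => by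
    rw [← Subgroup.map_map, hproj]
  have hinj : ∀ p : P, ∀ j ∈ mirrorSubgroup lam p, f j = 1 → j = 1 := by
    intro p j hj hfj
    have h1 : CentralExtension.proj a b j = 1 :=
      h.injOn p _ (hproj p ▸ Subgroup.mem_map_of_mem _ hj) hfj
    refine CentralExtension.eq_one_of_mem_closure (S := {i | p.1 ∈ i.1}) ?_ ?_ h1
    · by_contra! hcon
      have : p.1 ∈ F ∩ F' := hcon
      rw [hdisj] at this
      exact this
    · refine Subgroup.closure_mono ?_ hj
      rintro _ ⟨i, hi, rfl⟩
      exact ⟨i, hi, rfl⟩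
  obtain ⟨π, hπ⟩ := BasicConstruction.exists_isQuotientCoveringMap hf
    (hP.eventually_mirrorSubgroup_le lam) hmap hinj h.isQuotientMap h.apply_eq_iff
  have hconn := hP.pathConnectedSpace_basicConstruction lam (CentralExtension.closure_gen hab)
  obtain ⟨e, he⟩ := hπ.surjective x
  refine ⟨f.kerᵐᵒᵖ, inferInstance, hπ.fundamentalGroupToMulOpposite ⟨e, he⟩,
    hπ.fundamentalGroupToMulOpposite_surjective _, ?_⟩
  have h1 : Nat.card f.kerᵐᵒᵖ = Nat.card f.ker := Nat.card_congr MulOpposite.opEquiv.symm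
  have h2 : Nat.card f.ker * f.ker.index = Nat.card (CentralExtension a b) :=
    f.ker.card_mul_index
  rw [Subgroup.index_ker, MonoidHom.range_eq_top.mpr hf, Subgroup.card_top,
    CentralExtension.card_eq] at h2
  rw [h1, h2, Nat.card_coe_set_eq]

/-- The real moment-angle manifold is simply connected only if the polytope is 2-neighborly: a
simply connected space has no connected double covering. -/
theorem isTwoNeighborly_of_simplyConnectedSpace (hP : IsSimplePolytope P)
    (hS : SimplyConnectedSpace (RealMomentAngle P)) : IsTwoNeighborly P := by
  have hfin := hP.finite_facets_coe
  by_contra hN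
  obtain ⟨x⟩ : Nonempty (RealMomentAngle P) := inferInstance
  obtain ⟨K, _, f, hf, hcard⟩ :=
    isMomentAngleQuotient_realMomentAngle.exists_surjective hP hN x
  have hK : Subsingleton K := hf.subsingleton
  rw [Nat.card_of_subsingleton (1 : K), one_mul, Z2Power.card_eq, Nat.card_coe_set_eq] at hcard
  have := Nat.pow_right_injective le_rfl hcard
  omega

end Quotients

/-! ### Faithful representations of `(ℤ/2)^n` on `ℝⁿ` -/

section Representation

variable {κ V : Type*} [AddCommGroup V] [Module ℝ V]

lemma representation_apply_apply_self (ρ : Representation ℝ (Z2Power κ) V) (g : Z2Power κ) (v : V) :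
    ρ g (ρ g v) = v := by
  rw [← Module.End.mul_apply, ← map_mul, Z2Power.mul_self, map_one, Module.End.one_apply]

/-- The common eigenvectors of the commuting involutions `ρ g` span: decompose a vector
successively into its components in the eigenspaces for `1` and `-1` of each `ρ g`. -/
lemma span_eigenvectors [Finite κ] (ρ : Representation ℝ (Z2Power κ) V) :
    ⊤ ≤ Submodule.span ℝ {v : V | ∀ g, ρ g v = v ∨ ρ g v = -v} := by
  have := Fintype.ofFinite (Z2Power κ)
  have key : ∀ A : Finset (Z2Power κ), ∀ v : V,
      v ∈ Submodule.span ℝ {u : V | ∀ g ∈ A, ρ g u = u ∨ ρ g u = -u} := by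
    intro A
    induction A using Finset.cons_induction with
    | empty => intro v; exact Submodule.subset_span (by simp)
    | cons h A _ ih =>
      intro v
      refine Submodule.span_induction (p := fun v _ => v ∈ Submodule.span ℝ
        {u : V | ∀ g ∈ Finset.cons h A _, ρ g u = u ∨ ρ g u = -u}) ?_ (Submodule.zero_mem _)
        (fun _ _ _ _ => Submodule.add_mem _) (fun a _ _ => Submodule.smul_mem _ a) (ih v)
      intro u hu
      have hcomm : ∀ g, ρ g (ρ h u) = ρ h (ρ g u) := fun g => by
        rw [← Module.End.mul_apply, ← map_mul, mul_comm, map_mul, Module.End.mul_apply]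
      have hsplit : u = (1 / 2 : ℝ) • (u + ρ h u) + (1 / 2 : ℝ) • (u - ρ h u) := by
        module
      rw [hsplit]
      refine Submodule.add_mem _ (Submodule.smul_mem _ _ (Submodule.subset_span ?_))
        (Submodule.smul_mem _ _ (Submodule.subset_span ?_))
      · intro g hg
        rcases Finset.mem_cons.mp hg with rfl | hg
        · left
          rw [map_add, representation_apply_apply_self, add_comm]
        · rw [map_add, hcomm]
          rcases hu g hg with h1 | h1
          · left; rw [h1]
          · right; rw [h1, map_neg, neg_add]
      · intro g hg
        rcases Finset.mem_cons.mp hg with rfl | hg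
        · right
          rw [map_sub, representation_apply_apply_self, neg_sub]
        · rw [map_sub, hcomm]
          rcases hu g hg with h1 | h1
          · left; rw [h1]
          · right; rw [h1, map_neg]; abel
  intro v _
  refine Submodule.span_mono ?_ (key Finset.univ v)
  exact fun u hu g => hu g (Finset.mem_univ g)

variable {n : ℕ} {ι : Type*} {ρ : Representation ℝ (Z2Power (Fin n)) V} {b : Module.Basis ι ℝ V}

/-- The indices of the vectors of the eigenbasis `b` with eigenvalue `-1`. -/
def negIndices (ρ : Representation ℝ (Z2Power (Fin n)) V) (b : Module.Basis ι ℝ V)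
    (g : Z2Power (Fin n)) : Set ι :=
  {i | ρ g (b i) = -b i}

lemma basis_ne_neg (b : Module.Basis ι ℝ V) (i : ι) : b i ≠ -b i := by
  intro h
  have h1 := congrArg (fun v => b.repr v i) h
  simp only [map_neg, Finsupp.neg_apply, Module.Basis.repr_self, Finsupp.single_eq_same] at h1
  norm_num at h1

lemma repr_of_mem_negIndices (hb : ∀ i g, ρ g (b i) = b i ∨ ρ g (b i) = -b i)
    {g : Z2Power (Fin n)} {i : ι} (hi : i ∈ negIndices ρ b g) (v : V) :
    b.repr (ρ g v) i = -b.repr v i := by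
  classical
  have : (b.coord i) ∘ₗ (ρ g) = -b.coord i := by
    refine b.ext fun j => ?_
    by_cases hij : j = i
    · subst hij
      have hi' : ρ g (b j) = -b j := hi
      simp [hi']
    · rcases hb j g with h | h <;> simp [h, hij]
  exact LinearMap.congr_fun this v

lemma repr_of_notMem_negIndices (hb : ∀ i g, ρ g (b i) = b i ∨ ρ g (b i) = -b i)
    {g : Z2Power (Fin n)} {i : ι} (hi : i ∉ negIndices ρ b g) (v : V) :
    b.repr (ρ g v) i = b.repr v i := by
  classical
  have hi' : ρ g (b i) = b i := (hb i g).resolve_right hi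
  have : (b.coord i) ∘ₗ (ρ g) = b.coord i := by
    refine b.ext fun j => ?_
    by_cases hij : j = i
    · subst hij
      simp [hi']
    · rcases hb j g with h | h <;> simp [h, hij]
  exact LinearMap.congr_fun this v

lemma apply_eq_self_iff (hb : ∀ i g, ρ g (b i) = b i ∨ ρ g (b i) = -b i) {g : Z2Power (Fin n)}
    {v : V} : ρ g v = v ↔ ∀ i ∈ negIndices ρ b g, b.repr v i = 0 := by
  constructor
  · intro h i hi
    have := repr_of_mem_negIndices hb hi v
    rw [h] at this
    linarith
  · intro h
    refine b.ext_elem fun i => ?_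
    by_cases hi : i ∈ negIndices ρ b g
    · rw [repr_of_mem_negIndices hb hi, h i hi, neg_zero]
    · rw [repr_of_notMem_negIndices hb hi]

lemma negIndices_injective (hρ : Function.Injective ρ)
    (hb : ∀ i g, ρ g (b i) = b i ∨ ρ g (b i) = -b i) :
    Function.Injective (negIndices ρ b) := by
  intro g g' h
  refine hρ (b.ext fun i => ?_)
  by_cases hi : i ∈ negIndices ρ b g
  · have h1 : ρ g (b i) = -b i := hi
    have h2 : ρ g' (b i) = -b i := by rw [h] at hi; exact hi
    rw [h1, h2]
  · have h1 := (hb i g).resolve_right hi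
    have h2 := (hb i g').resolve_right (by rw [h] at hi; exact hi)
    rw [h1, h2]

/-- A faithful representation of `(ℤ/2)^n` in dimension `n` contains all sign changes of the
coordinates with respect to an eigenbasis, by counting. -/
lemma negIndices_surjective [Finite ι] (hι : Nat.card ι = n) (hρ : Function.Injective ρ)
    (hb : ∀ i g, ρ g (b i) = b i ∨ ρ g (b i) = -b i) :
    Function.Surjective (negIndices ρ b) := by
  refine ((Nat.bijective_iff_injective_and_card _).mpr ⟨negIndices_injective hρ hb, ?_⟩).2
  change Nat.card (Fin n → ZMod 2) = Nat.card (ι → Prop)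
  simp [Nat.card_fun, hι]

lemma negIndices_mul (hb : ∀ i g, ρ g (b i) = b i ∨ ρ g (b i) = -b i)
    {g t : Z2Power (Fin n)} {i : ι} (hi : i ∈ negIndices ρ b g) (ht : negIndices ρ b t = {i}) :
    negIndices ρ b (g * t) = negIndices ρ b g \ {i} := by
  ext j
  have hne := basis_ne_neg b j
  rw [mem_sdiff, mem_singleton_iff]
  change ρ (g * t) (b j) = -b j ↔ _
  rw [map_mul, Module.End.mul_apply]
  by_cases hji : j = i
  · subst hji
    have h1 : ρ t (b j) = -b j := by
      have : j ∈ negIndices ρ b t := ht ▸ mem_singleton j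
      exact this
    have h2 : ρ g (b j) = -b j := hi
    rw [h1, map_neg, h2, neg_neg]
    simp [hne]
  · have h1 : ρ t (b j) = b j := (hb j t).resolve_right fun h => by
      have : j ∈ negIndices ρ b t := h
      rw [ht] at this
      exact hji this
    rw [h1]
    simp [hji, negIndices]

lemma mem_closure_of_negIndices (hρ : Function.Injective ρ)
    (hb : ∀ i g, ρ g (b i) = b i ∨ ρ g (b i) = -b i) {t : ι → Z2Power (Fin n)}
    (ht : ∀ i, negIndices ρ b (t i) = {i}) (A : Set ι) (hA : A.Finite) :
    ∀ g, negIndices ρ b g = A → g ∈ Subgroup.closure (t '' A) := by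
  induction A, hA using Set.Finite.induction_on with
  | empty =>
    intro g hg
    have h1 : negIndices ρ b 1 = ∅ := by
      refine eq_empty_of_forall_notMem fun i hi => basis_ne_neg b i ?_
      have hi' : ρ 1 (b i) = -b i := hi
      rwa [map_one, Module.End.one_apply] at hi'
    rw [negIndices_injective hρ hb (hg.trans h1.symm)]
    exact one_mem _
  | @insert i A hi _ ih =>
    intro g hg
    have hig : i ∈ negIndices ρ b g := hg ▸ mem_insert i A
    have h1 := negIndices_mul hb hig (ht i)
    rw [hg, insert_sdiff_self_of_notMem hi] at h1
    have h2 : g = g * t i * t i := by rw [mul_assoc, Z2Power.mul_self, mul_one]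
    rw [h2]
    exact mul_mem (Subgroup.closure_mono (image_mono (subset_insert i A)) (ih _ h1))
      (Subgroup.subset_closure ⟨i, mem_insert i A, rfl⟩)

/-- In a faithful representation of `(ℤ/2)^n` on `ℝⁿ`, the isotropy group of a vector `v` is
generated by the reflections that are the only nontrivial element of the isotropy group of some
vector near `v`. -/
lemma mem_closure_reflections {ρ : Representation ℝ (Z2Power (Fin n)) (EuclideanSpace ℝ (Fin n))}
    (hρ : Function.Injective ρ) {v : EuclideanSpace ℝ (Fin n)}
    {U : Set (EuclideanSpace ℝ (Fin n))} (hU : U ∈ 𝓝 v) {g : Z2Power (Fin n)} (hg : ρ g v = v) :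
    g ∈ Subgroup.closure {t | t ≠ 1 ∧ ∃ y ∈ U, ∀ h, ρ h y = y ↔ h = 1 ∨ h = t} := by
  let b := Module.Basis.ofSpan (span_eigenvectors ρ)
  have hb : ∀ i g, ρ g (b i) = b i ∨ ρ g (b i) = -b i := fun i =>
    Module.Basis.ofSpan_subset (span_eigenvectors ρ) ⟨i, rfl⟩
  have := Module.Finite.finite_basis b
  have hι := (Module.finrank_eq_nat_card_basis b).symm
  rw [finrank_euclideanSpace_fin] at hι
  choose t ht using fun i => negIndices_surjective hι hρ hb {i}
  refine Subgroup.closure_mono ?_ (mem_closure_of_negIndices hρ hb ht _ (toFinite _) g rfl)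
  rintro _ ⟨i, hi, rfl⟩
  have hvi : b.repr v i = 0 := (apply_eq_self_iff hb).mp hg i hi
  have hti : ρ (t i) (b i) = -b i := by
    have : i ∈ negIndices ρ b (t i) := ht i ▸ mem_singleton i
    exact this
  refine ⟨fun h => basis_ne_neg b i ?_, ?_⟩
  · rwa [h, map_one, Module.End.one_apply] at hti
  -- perturb all vanishing coordinates of `v` except for the one with index `i`
  classical
  have := Fintype.ofFinite ↑((linearIndepOn_empty ℝ id).extend
    (empty_subset {v : EuclideanSpace ℝ (Fin n) | ∀ g, ρ g v = v ∨ ρ g v = -v}))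
  let d : EuclideanSpace ℝ (Fin n) :=
    b.equivFun.symm fun j => if j ≠ i ∧ b.repr v j = 0 then 1 else 0
  have hd : ∀ j, b.repr d j = if j ≠ i ∧ b.repr v j = 0 then 1 else 0 := fun j => by
    rw [← b.equivFun_apply, LinearEquiv.apply_symm_apply]
  have hcont : Filter.Tendsto (fun ε : ℝ => v + ε • d) (𝓝[>] 0) (𝓝 v) := by
    have h1 : Continuous fun ε : ℝ => v + ε • d := by fun_prop
    have h2 := h1.tendsto 0
    rw [zero_smul, add_zero] at h2
    exact h2.mono_left nhdsWithin_le_nhds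
  obtain ⟨ε, hεU, hε⟩ := ((hcont.eventually_mem hU).and self_mem_nhdsWithin).exists
  have hε' : ε ≠ 0 := (ne_of_lt hε).symm
  have hrepr : ∀ j, b.repr (v + ε • d) j = 0 ↔ j = i := by
    intro j
    rw [map_add, map_smul, Finsupp.add_apply, Finsupp.smul_apply, hd, smul_eq_mul]
    by_cases hji : j = i
    · simp [hji, hvi]
    · by_cases hvj : b.repr v j = 0
      · simp [hji, hvj, hε']
      · simp [hji, hvj]
  refine ⟨_, hεU, fun h => ?_⟩
  rw [apply_eq_self_iff hb]
  simp only [hrepr]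
  constructor
  · intro hh
    by_cases hih : i ∈ negIndices ρ b h
    · right
      refine negIndices_injective hρ hb ?_
      rw [ht]
      ext j
      exact ⟨hh j, fun hj => by rw [mem_singleton_iff.mp hj]; exact hih⟩
    · left
      refine hρ (b.ext fun j => ?_)
      have hj : j ∉ negIndices ρ b h := fun hj => hih (hh j hj ▸ hj)
      rw [map_one, Module.End.one_apply]
      exact (hb j h).resolve_right hj
  · rintro (rfl | rfl) j hj
    · have hj' : ρ 1 (b j) = -b j := hj
      rw [map_one, Module.End.one_apply] at hj'
      exact absurd hj' (basis_ne_neg b j)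
    · rw [ht] at hj
      exact hj

end Representation

/-! ### Sections of orbit maps over convex sets -/

section Section

variable {E M G : Type*} [NormedAddCommGroup E] [NormedSpace ℝ E] {P : Set E}
  [TopologicalSpace M] [T2Space M] [CompactSpace M] [Group G] [Finite G] [MulAction G M]
  [ContinuousConstSMul G M]

/-- If the orbit space of a finite group is a convex set `P` and the action is free over the
interior of `P`, then the orbit map is a covering over the interior, and hence it has a section
there. -/
lemma exists_section_interior (hP : Convex ℝ P) (hne : (interior P).Nonempty)
    (h : MulAction.orbitRel.Quotient G M ≃ₜ P)
    (hfree : ∀ x : M, (h (Quotient.mk _ x)).1 ∈ interior P → MulAction.stabilizer G x = ⊥) :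
    ∃ s : C(interior P, M), ∀ p, (h (Quotient.mk _ (s p))).1 = p.1 := by
  have : ContractibleSpace (interior P) := hP.interior.contractibleSpace hne
  have : LocallyPathConnectedSpace (interior P) := isOpen_interior.locallyPathConnectedSpace
  let f : C(interior P, MulAction.orbitRel.Quotient G M) :=
    ⟨fun p => h.symm ⟨p.1, interior_subset p.2⟩, by fun_prop⟩
  obtain ⟨p₀⟩ : Nonempty (interior P) := hne.to_subtype
  obtain ⟨x₀, hx₀⟩ := Quotient.exists_rep (f p₀)
  obtain ⟨s, ⟨-, hs⟩, -⟩ :=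
    (isCoveringMapOn_quotientMk_of_properlyDiscontinuousSMul (G := G)
      (E := M)).existsUnique_continuousMap_lifts f (a₀ := p₀) (e₀ := x₀) hx₀ (fun p => by
        obtain ⟨x, hx⟩ := Quotient.exists_rep (f p)
        refine ⟨x, hfree x ?_, hx⟩
        rw [hx]
        simp [f])
  refine ⟨s, fun p => ?_⟩
  have := congrFun hs p
  simp only [Function.comp_apply] at this
  rw [this]
  simp [f]

/-- The orbit map of a finite group action has a section if the orbit space is a convex set `P` and
the action is free over the interior of `P`: a section over the interior extends continuously, since
on the intersection of the interior with a small ball around a boundary point `p` it stays in one of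
disjoint neighbourhoods of the finitely many points of the orbit over `p`. -/
lemma exists_section_orbitMap (hP : Convex ℝ P) (hne : (interior P).Nonempty)
    (h : MulAction.orbitRel.Quotient G M ≃ₜ P)
    (hfree : ∀ x : M, (h (Quotient.mk _ x)).1 ∈ interior P → MulAction.stabilizer G x = ⊥) :
    ∃ s : C(P, M), ∀ p, h (Quotient.mk _ (s p)) = p := by
  obtain ⟨s, hs⟩ := exists_section_interior hP hne h hfree
  let i : interior P → P := Set.inclusion interior_subset
  have hi : IsDenseInducing i := by
    refine ⟨⟨(Topology.IsEmbedding.inclusion interior_subset).eq_induced⟩, ?_⟩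
    intro p
    rw [closure_subtype]
    have h1 : Subtype.val '' range i = interior P := by
      ext x
      constructor
      · rintro ⟨_, ⟨y, rfl⟩, rfl⟩
        exact y.2
      · intro hx
        exact ⟨_, ⟨⟨x, hx⟩, rfl⟩, rfl⟩
    rw [h1, hP.closure_interior_eq_closure_of_nonempty_interior hne]
    exact subset_closure p.2
  let q : M → P := fun x => h (Quotient.mk _ x)
  have hq : Continuous q := h.continuous.comp continuous_quotient_mk'
  have hqc : IsClosedMap q := by
    have : CompactSpace P := by
      have : CompactSpace (MulAction.orbitRel.Quotient G M) := Quotient.compactSpace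
      exact h.compactSpace
    exact hq.isClosedMap
  have hqs : ∀ p, q (s p) = i p := fun p => Subtype.ext (hs p)
  have hlim : ∀ p : P, ∃ x, Filter.Tendsto s (Filter.comap i (𝓝 p)) (𝓝 x) := by
    intro p
    have : (Filter.comap i (𝓝 p)).NeBot := hi.comap_nhds_neBot p
    obtain ⟨x, hx⟩ := exists_clusterPt_of_compactSpace (Filter.map s (Filter.comap i (𝓝 p)))
    refine ⟨x, fun O hO => ?_⟩
    have hqx : q x = p := by
      have h1 : ClusterPt (q x) (Filter.map q (Filter.map s (Filter.comap i (𝓝 p)))) :=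
        hx.map hq.continuousAt Filter.tendsto_map
      have h2 : Filter.map q (Filter.map s (Filter.comap i (𝓝 p))) ≤ 𝓝 p := by
        rw [Filter.map_map, show q ∘ s = i from funext hqs]
        exact Filter.map_comap_le
      exact eq_of_nhds_neBot (h1.mono h2)
    have hfib : (q ⁻¹' {p}).Finite := by
      refine (Set.finite_range fun g : G => g • x).subset fun y hy => ?_
      have : q y = q x := hy.trans hqx.symm
      exact Quotient.exact (h.injective this)
    -- separate `x` from the other points of its orbit
    obtain ⟨A, B, hA, hB, hxA, hFB, hAB⟩ : ∃ A B : Set M, IsOpen A ∧ IsOpen B ∧ x ∈ A ∧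
        q ⁻¹' {p} \ {x} ⊆ B ∧ Disjoint A B := by
      obtain ⟨A, B, hA, hB, h1, h2, h3⟩ := SeparatedNhds.of_isCompact_isCompact
        (isCompact_singleton (x := x)) (hfib.subset sdiff_subset).isCompact
        (disjoint_sdiff_right (s := {x}) (t := q ⁻¹' {p}))
      exact ⟨A, B, hA, hB, h1 rfl, h2, h3⟩
    have hcover : q ⁻¹' {p} ⊆ (A ∩ interior O) ∪ B := by
      intro y hy
      by_cases hyx : y = x
      · exact Or.inl ⟨hyx ▸ hxA, hyx ▸ mem_interior_iff_mem_nhds.mpr hO⟩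
      · exact Or.inr (hFB ⟨hy, hyx⟩)
    have hOo : IsOpen ((A ∩ interior O) ∪ B) := (hA.inter isOpen_interior).union hB
    have hev : ∀ᶠ p' in 𝓝 p, q ⁻¹' {p'} ⊆ (A ∩ interior O) ∪ B := by
      have := isClosedMap_iff_kernImage.mp hqc hOo
      filter_upwards [this.mem_nhds (show p ∈ kernImage q _ from fun y hy => hcover hy)] with p' hp'
      exact fun y hy => hp' hy
    obtain ⟨r, hr, hball⟩ := Metric.eventually_nhds_iff_ball.mp hev
    -- a small ball meets the interior in a convex set, whose image is connected
    let C : Set (interior P) := {y | y.1 ∈ Metric.ball p.1 r}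
    have hCconn : IsPreconnected C := by
      have h1 : IsPreconnected (interior P ∩ Metric.ball p.1 r) :=
        (hP.interior.inter (convex_ball _ _)).isPreconnected
      refine Topology.IsInducing.subtypeVal.isPreconnected_image.mp ?_
      convert h1
      ext y
      exact ⟨fun ⟨z, hz, hzy⟩ => hzy ▸ ⟨z.2, hz⟩, fun hy => ⟨⟨y, hy.1⟩, hy.2, rfl⟩⟩
    have hCmem : C ∈ Filter.comap i (𝓝 p) :=
      ⟨Metric.ball p r, Metric.ball_mem_nhds p hr, fun y hy => hy⟩
    have hsub : s '' C ⊆ (A ∩ interior O) ∪ B := by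
      rintro _ ⟨y, hy, rfl⟩
      exact hball (i y) hy (hqs y)
    obtain ⟨z, hz⟩ : (s '' C ∩ (A ∩ interior O)).Nonempty := by
      have h1 : (A ∩ interior O) ∈ 𝓝 x :=
        (hA.inter isOpen_interior).mem_nhds ⟨hxA, mem_interior_iff_mem_nhds.mpr hO⟩
      have h2 := clusterPt_iff_nonempty.mp hx h1 (Filter.image_mem_map hCmem)
      rwa [inter_comm] at h2
    have hsA := (hCconn.image s s.continuous.continuousOn).subset_left_of_subset_union
      (hA.inter isOpen_interior) hB (hAB.mono_left inter_subset_left) hsub ⟨z, hz⟩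
    refine Filter.mem_map.mpr (Filter.mem_of_superset hCmem fun y hy => ?_)
    exact interior_subset (s := O) (hsA ⟨y, hy, rfl⟩).2
  have hext : Continuous (hi.extend s) := hi.continuous_extend hlim
  refine ⟨⟨hi.extend s, hext⟩, fun p => ?_⟩
  have h1 : q ∘ hi.extend s = id := by
    refine hi.dense.equalizer (hq.comp hext) continuous_id ?_
    funext y
    simp only [Function.comp_apply, id]
    rw [hi.extend_eq s.continuous, hqs]
  exact congrFun h1 p

end Section

/-! ### Small covers -/

section Stabilizers

variable {G M : Type*}

/-- Isotropy groups of a finite group are upper semicontinuous. -/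
lemma eventually_stabilizer_le [TopologicalSpace M] [Group G] [Finite G] [MulAction G M]
    [ContinuousConstSMul G M] [T2Space M] (x : M) :
    ∀ᶠ y in 𝓝 x, MulAction.stabilizer G y ≤ MulAction.stabilizer G x := by
  have h : ∀ g : G, ∀ᶠ y in 𝓝 x, g • y = y → g • x = x := by
    intro g
    by_cases hg : g • x = x
    · exact Filter.Eventually.of_forall fun _ _ => hg
    · have : IsOpen {y : M | g • y ≠ y} := isOpen_ne_fun (continuous_const_smul g) continuous_id
      filter_upwards [this.mem_nhds hg] with y hy h
      exact absurd h hy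
  filter_upwards [Filter.eventually_all.mpr h] with y hy g hg
  exact hy g hg

lemma stabilizer_eq_of_mk_eq [CommGroup G] [MulAction G M] {x y : M}
    (h : (Quotient.mk (MulAction.orbitRel G M) x) = Quotient.mk _ y) :
    MulAction.stabilizer G x = MulAction.stabilizer G y := by
  obtain ⟨g, hg⟩ := Quotient.exact h
  obtain rfl : g • y = x := hg
  ext k
  rw [MulAction.mem_stabilizer_iff, MulAction.mem_stabilizer_iff, smul_smul, mul_comm, ← smul_smul,
    smul_left_cancel_iff]

end Stabilizers

section SmallCover

variable {n : ℕ} {P : Set (EuclideanSpace ℝ (Fin n))} {M : Type*} [TopologicalSpace M] [T2Space M]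
  [CompactSpace M] [MulAction (Z2Power (Fin n)) M] [ContinuousConstSMul (Z2Power (Fin n)) M]
  {h : MulAction.orbitRel.Quotient (Z2Power (Fin n)) M ≃ₜ P}

lemma exists_section_smallCover (hP : IsSimplePolytope P)
    (hstab : ∀ x : M, Nat.card (MulAction.stabilizer (Z2Power (Fin n)) x) =
      2 ^ (facetsThrough P (h (Quotient.mk _ x))).ncard) :
    ∃ s : C(P, M), ∀ p, h (Quotient.mk _ (s p)) = p := by
  refine exists_section_orbitMap hP.convex hP.interior_nonempty h fun x hx => ?_
  have := hstab x
  rw [facetsThrough_eq_empty_of_mem_interior hx, ncard_empty, pow_zero] at this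
  exact Subgroup.card_eq_one.mp this

variable {s : C(P, M)}

omit [CompactSpace M] in
/-- The isotropy group has order two over the relative interior of a facet. As this set is
connected, the isotropy group is constant there. -/
lemma exists_characteristic_element (hP : IsSimplePolytope P)
    (hcard : ∀ p : P, Nat.card (MulAction.stabilizer (Z2Power (Fin n)) (s p)) =
      2 ^ (facetsThrough P p).ncard) (F : facets P) :
    ∃ t : Z2Power (Fin n), ∀ p : P, p.1 ∈ facetInterior P F.1 →
      ∀ g, g • s p = s p ↔ g = 1 ∨ g = t := by
  have hF : IsFacet P F.1 := F.2
  let A : Set P := {p | p.1 ∈ facetInterior P F.1}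
  have hcardA : ∀ p ∈ A, Nat.card (MulAction.stabilizer (Z2Power (Fin n)) (s p)) = 2 := by
    intro p hp
    rw [hcard, (facetsThrough_eq_singleton_iff hF).mpr hp, ncard_singleton, pow_one]
  have hA : IsPreconnected A := by
    refine Topology.IsInducing.subtypeVal.isPreconnected_image.mp ?_
    convert (hF.convex_facetInterior hP.convex).isPreconnected
    ext y
    exact ⟨fun ⟨z, hz, hzy⟩ => hzy ▸ hz, fun hy => ⟨⟨y, hF.subset hy.1⟩, hy, rfl⟩⟩
  let : TopologicalSpace (Subgroup (Z2Power (Fin n))) := ⊥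
  have : DiscreteTopology (Subgroup (Z2Power (Fin n))) := ⟨rfl⟩
  have hcont : ContinuousOn (fun p : P => MulAction.stabilizer (Z2Power (Fin n)) (s p)) A := by
    intro p hp
    refine tendsto_const_nhds.congr' ?_
    have h1 : ∀ᶠ q in 𝓝[A] p, MulAction.stabilizer (Z2Power (Fin n)) (s q) ≤
        MulAction.stabilizer (Z2Power (Fin n)) (s p) :=
      ((s.continuous.tendsto p).eventually (eventually_stabilizer_le (s p))).filter_mono
        nhdsWithin_le_nhds
    filter_upwards [h1, self_mem_nhdsWithin] with q hq hqA
    refine (Subgroup.eq_of_le_of_card_ge hq ?_).symm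
    rw [hcardA p hp, hcardA q hqA]
  obtain ⟨p₀, hp₀⟩ := hP.facetInterior_nonempty hF
  have hp₀A : (⟨p₀, hF.subset hp₀.1⟩ : P) ∈ A := hp₀
  obtain ⟨⟨t, ht⟩, ht1, htu⟩ := (Nat.card_eq_two_iff' 1).mp (hcardA _ hp₀A)
  refine ⟨t, fun p hp g => ?_⟩
  have hconst := hA.constant hcont hp hp₀A
  rw [← MulAction.mem_stabilizer_iff, hconst]
  constructor
  · intro hg
    by_cases hg1 : g = 1
    · exact Or.inl hg1
    · right
      have := htu ⟨g, hg⟩ (fun h => hg1 (congrArg Subtype.val h))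
      exact congrArg Subtype.val this
  · rintro (rfl | rfl)
    · exact one_mem _
    · exact ht

omit [CompactSpace M] in
/-- The elements `lam F` generating the isotropy groups over the relative interiors of the facets
generate all isotropy groups: by density `lam F` fixes all points over `F`, and by local
standardness an isotropy group is generated by elements that generate the isotropy group of a
nearby point. -/
lemma exists_characteristic_function (hP : IsSimplePolytope P) (hM : IsLocallyStandard n M)
    (hstab : ∀ x : M, Nat.card (MulAction.stabilizer (Z2Power (Fin n)) x) =
      2 ^ (facetsThrough P (h (Quotient.mk _ x))).ncard)
    (hs : ∀ p, h (Quotient.mk _ (s p)) = p) :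
    ∃ lam : facets P → Z2Power (Fin n), ∀ p : P,
      MulAction.stabilizer (Z2Power (Fin n)) (s p) = mirrorSubgroup lam p := by
  have hcard : ∀ p : P, Nat.card (MulAction.stabilizer (Z2Power (Fin n)) (s p)) =
      2 ^ (facetsThrough P p).ncard := fun p => by rw [hstab, hs]
  choose lam hlam using exists_characteristic_element hP hcard
  refine ⟨lam, fun p => le_antisymm ?_ ?_⟩
  · obtain ⟨ρ, hρ, φ, hφ, hequiv⟩ := hM (s p)
    let q : M → P := fun x => h (Quotient.mk _ x)
    have hq : Continuous q := h.continuous.comp continuous_quotient_mk'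
    have hU : φ.target ∩ φ.symm ⁻¹' (q ⁻¹' openStar P p) ∈ 𝓝 (φ (s p)) := by
      refine Filter.inter_mem (φ.open_target.mem_nhds (φ.map_source hφ)) ?_
      refine (φ.symm.continuousAt (φ.map_source hφ)).preimage_mem_nhds ?_
      rw [φ.left_inv hφ]
      refine ((hP.isOpen_openStar p).preimage hq).mem_nhds ?_
      change q (s p) ∈ openStar P p
      rw [show q (s p) = p from hs p]
      exact mem_openStar_self p
    intro g hg
    have hg' : ρ g (φ (s p)) = φ (s p) := by
      rw [← (hequiv g _ hφ).2, MulAction.mem_stabilizer_iff.mp hg]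
    refine (Subgroup.closure_le _).mpr ?_ (mem_closure_reflections hρ hU hg')
    rintro t ⟨ht1, y, ⟨hyt, hyU⟩, hy⟩
    have hm : φ.symm y ∈ φ.source := φ.map_target hyt
    have hfix : ∀ k : Z2Power (Fin n), k • φ.symm y = φ.symm y ↔ k = 1 ∨ k = t := by
      intro k
      rw [← hy k]
      have h1 := (hequiv k _ hm)
      rw [φ.right_inv hyt] at h1
      rw [← h1.2]
      constructor
      · intro h2; rw [h2, φ.right_inv hyt]
      · intro h2
        refine φ.injOn h1.1 hm ?_
        rw [h2, φ.right_inv hyt]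
    -- the isotropy group of the nearby point has order two, so exactly one facet contains its image
    have hcard2 : Nat.card (MulAction.stabilizer (Z2Power (Fin n)) (φ.symm y)) = 2 := by
      rw [Nat.card_eq_two_iff' 1]
      refine ⟨⟨t, (hfix t).mpr (Or.inr rfl)⟩, fun h => ht1 (congrArg Subtype.val h), ?_⟩
      rintro ⟨k, hk⟩ hk1
      exact Subtype.ext (((hfix k).mp hk).resolve_left fun h => hk1 (Subtype.ext h))
    rw [hstab] at hcard2
    obtain ⟨F, hF⟩ := ncard_eq_one.mp
      (Nat.pow_right_injective le_rfl (hcard2.trans (pow_one 2).symm))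
    have hFm : F ∈ facetsThrough P (q (φ.symm y)) := hF ▸ mem_singleton F
    have hFint := (facetsThrough_eq_singleton_iff hFm.1).mp hF
    have hstabeq : MulAction.stabilizer (Z2Power (Fin n)) (φ.symm y) =
        MulAction.stabilizer (Z2Power (Fin n)) (s (q (φ.symm y))) :=
      stabilizer_eq_of_mk_eq (h.injective (hs (q (φ.symm y))).symm)
    have htm : t ∈ MulAction.stabilizer (Z2Power (Fin n)) (s (q (φ.symm y))) := by
      rw [← hstabeq]
      exact (hfix t).mpr (Or.inr rfl)
    obtain rfl : t = lam ⟨F, hFm.1⟩ :=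
      ((hlam ⟨F, hFm.1⟩ _ hFint t).mp htm).resolve_left ht1
    exact mem_mirrorSubgroup lam (F := ⟨F, hFm.1⟩) (hyU F hFm.1 hFm.2)
  · rw [mirrorSubgroup, Subgroup.closure_le]
    rintro _ ⟨F, hpF, rfl⟩
    have hF : IsFacet P F.1 := F.2
    have hcl : IsClosed {q : P | lam F • s q = s q} :=
      isClosed_eq (s.continuous.const_smul _) s.continuous
    have hsub : {q : P | q.1 ∈ facetInterior P F.1} ⊆ {q : P | lam F • s q = s q} :=
      fun q hq => (hlam F q hq _).mpr (Or.inr rfl)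
    refine closure_minimal hsub hcl ?_
    rw [closure_subtype]
    convert hP.subset_closure_facetInterior hF hpF
    ext y
    exact ⟨fun ⟨z, hz, hzy⟩ => hzy ▸ hz, fun hy => ⟨⟨y, hF.subset hy.1⟩, hy, rfl⟩⟩

omit [T2Space M] [CompactSpace M] [ContinuousConstSMul (Z2Power (Fin n)) M] in
/-- Over a vertex the isotropy group is the whole group, and so the `lam F` generate it. -/
lemma closure_characteristic_function (hP : IsSimplePolytope P)
    (hcard : ∀ p : P, Nat.card (MulAction.stabilizer (Z2Power (Fin n)) (s p)) =
      2 ^ (facetsThrough P p).ncard) {lam : facets P → Z2Power (Fin n)}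
    (hlam : ∀ p : P, MulAction.stabilizer (Z2Power (Fin n)) (s p) = mirrorSubgroup lam p) :
    Subgroup.closure (range lam) = ⊤ := by
  obtain ⟨v, hv⟩ := hP.isCompact.extremePoints_nonempty hP.nonempty
  have hvP : v ∈ P := extremePoints_subset hv
  have h1 := hcard ⟨v, hvP⟩
  rw [ncard, hP.simple v hv, ENat.toNat_natCast] at h1
  have h2 : MulAction.stabilizer (Z2Power (Fin n)) (s ⟨v, hvP⟩) = ⊤ := by
    refine Subgroup.eq_top_of_card_eq _ ?_
    rw [h1]
    rw [Z2Power.card_eq, Nat.card_fin]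
  rw [hlam] at h2
  refine top_unique (h2 ▸ Subgroup.closure_mono ?_)
  rintro _ ⟨F, -, rfl⟩
  exact mem_range_self F

omit [TopologicalSpace M] [T2Space M] [CompactSpace M] [MulAction (Z2Power (Fin n)) M]
  [ContinuousConstSMul (Z2Power (Fin n)) M] in
lemma card_faceSubgroup_le (hP : IsSimplePolytope P) (p : P) :
    Nat.card (faceSubgroup P p) ≤ 2 ^ (facetsThrough P p).ncard := by
  have hfin := hP.finite_facets_coe
  have hfin' : Finite (facetsThrough P p) := hP.facetsThrough_finite p
  have hzero : ∀ g ∈ faceSubgroup P p, ∀ F : facets P, p.1 ∉ F.1 →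
      Multiplicative.toAdd g F = 0 := by
    intro g hg
    induction hg using Subgroup.closure_induction with
    | mem g hg =>
      obtain ⟨F', hF', rfl⟩ := hg
      intro F hF
      have hne : F ≠ F' := fun h => hF (h ▸ hF')
      simp [facetVector, hne]
    | one => intro F _; rfl
    | mul a b _ _ ha hb => intro F hF; simp [ha F hF, hb F hF]
    | inv a _ ha => intro F hF; simp [ha F hF]
  have hinj : Function.Injective (fun (g : faceSubgroup P p) (F : facetsThrough P p) =>
      Multiplicative.toAdd g.1 ⟨F.1, F.2.1⟩) := by
    intro g g' h
    refine Subtype.ext (Multiplicative.toAdd.injective (funext fun F => ?_))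
    by_cases hF : p.1 ∈ F.1
    · exact congrFun h ⟨F.1, F.2, hF⟩
    · rw [hzero _ g.2 F hF, hzero _ g'.2 F hF]
  refine (Nat.card_le_card_of_injective _ hinj).trans ?_
  rw [Nat.card_fun, Nat.card_zmod, Nat.card_coe_set_eq]

/-- A small cover is the quotient of `ℝ𝒵_P` defined by its characteristic function. -/
lemma exists_isMomentAngleQuotient (hP : IsSimplePolytope P) (hM : IsLocallyStandard n M)
    (hstab : ∀ x : M, Nat.card (MulAction.stabilizer (Z2Power (Fin n)) x) =
      2 ^ (facetsThrough P (h (Quotient.mk _ x))).ncard) :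
    ∃ (φ : Z2Power (facets P) →* Z2Power (Fin n)) (Ψ : P × Z2Power (Fin n) → M),
      IsMomentAngleQuotient φ Ψ := by
  have hfin := hP.finite_facets_coe
  obtain ⟨s, hs⟩ := exists_section_smallCover hP hstab
  have hcard : ∀ p : P, Nat.card (MulAction.stabilizer (Z2Power (Fin n)) (s p)) =
      2 ^ (facetsThrough P p).ncard := fun p => by rw [hstab, hs]
  obtain ⟨lam, hlam⟩ := exists_characteristic_function hP hM hstab hs
  obtain ⟨φ, hφ⟩ := exists_monoidHom_facetVector hfin lam (fun F => Z2Power.mul_self _)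
    (fun F G => Commute.all _ _)
  have hmap : ∀ p : P, (faceSubgroup P p).map φ =
      MulAction.stabilizer (Z2Power (Fin n)) (s p) := by
    intro p
    have := map_mirrorSubgroup (facetVector P) φ p
    simp only [hφ] at this
    rw [hlam]
    exact this
  refine ⟨φ, fun a => a.2 • s a.1, ⟨?_, ?_, ?_, ?_⟩⟩
  · rw [← MonoidHom.range_eq_top, ← top_le_iff, ← closure_characteristic_function hP hcard hlam,
      Subgroup.closure_le]
    rintro _ ⟨F, rfl⟩
    exact ⟨_, hφ F⟩
  · -- the restriction of `φ` to the isotropy group is surjective between groups of the same order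
    intro p j hj hj1
    have hsurj : Function.Surjective (φ.subgroupMap (faceSubgroup P p)) :=
      φ.subgroupMap_surjective _
    have hle : Nat.card (faceSubgroup P p) ≤ Nat.card ((faceSubgroup P p).map φ) := by
      rw [hmap, hcard]
      exact card_faceSubgroup_le hP p
    have hbij := hsurj.bijective_of_nat_card_le hle
    have : (⟨j, hj⟩ : faceSubgroup P p) = 1 := hbij.1 (by
      rw [map_one]
      exact Subtype.ext hj1)
    exact congrArg Subtype.val this
  · have : CompactSpace P := isCompact_iff_compactSpace.mp hP.isCompact
    have hc : Continuous fun a : P × Z2Power (Fin n) => a.2 • s a.1 := by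
      rw [continuous_prod_of_discrete_right]
      intro g
      exact s.continuous.const_smul g
    refine hc.isClosedMap.isQuotientMap hc fun x => ?_
    have h1 : Quotient.mk (MulAction.orbitRel (Z2Power (Fin n)) M) x =
        Quotient.mk _ (s (h (Quotient.mk _ x))) := h.injective (hs _).symm
    obtain ⟨g, hg⟩ := Quotient.exact h1
    exact ⟨(_, g), hg⟩
  · rintro ⟨p, g⟩ ⟨p', g'⟩
    have hproj : ∀ (p : P) (g : Z2Power (Fin n)),
        h (Quotient.mk (MulAction.orbitRel (Z2Power (Fin n)) M) (g • s p)) = p := fun p g => by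
      rw [show Quotient.mk (MulAction.orbitRel (Z2Power (Fin n)) M) (g • s p) =
        Quotient.mk _ (s p) from Quotient.sound ⟨g, rfl⟩, hs]
    rw [hmap]
    dsimp only
    rw [MulAction.mem_stabilizer_iff, mul_smul, inv_smul_eq_iff]
    constructor
    · intro heq
      have h1 := hproj p g
      rw [heq, hproj] at h1
      subst h1
      exact ⟨rfl, heq.symm⟩
    · rintro ⟨rfl, heq⟩
      exact heq.symm

end SmallCover

/-! ### Fundamental groups of small covers -/

section FundamentalGroups

/-- A finite group of exponent two is determined by its order. -/
lemma nonempty_mulEquiv_Z2Power {K : Type*} [CommGroup K] [Finite K] (h : ∀ x : K, x * x = 1)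
    {m : ℕ} (hc : Nat.card K = 2 ^ m) : Nonempty (K ≃* Z2Power (Fin m)) := by
  let : Module (ZMod 2) (Additive K) := AddCommGroup.zmodModule fun x => by
    rw [two_nsmul]
    exact h x.toMul
  have h1 : Nat.card (Additive K) = 2 ^ Module.finrank (ZMod 2) (Additive K) := by
    rw [Module.natCard_eq_pow_finrank (K := ZMod 2), Nat.card_zmod]
  have h2 : Module.finrank (ZMod 2) (Additive K) = m :=
    Nat.pow_right_injective le_rfl (h1.symm.trans hc)
  let e : Additive K ≃ₗ[ZMod 2] (Fin m → ZMod 2) :=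
    LinearEquiv.ofFinrankEq _ _ (by rw [h2, Module.finrank_fin_fun])
  exact ⟨AddEquiv.toMultiplicativeRight e.toAddEquiv⟩

/-- For a small cover `X`, the kernel of `φ : (ℤ/2)^r → (ℤ/2)^n` is elementary abelian of order
`2 ^ (r - n)`. If `P` is not 2-neighborly, then `π₁(X)` has at least twice as many elements. -/
lemma IsMomentAngleQuotient.isTwoNeighborly_iff {n : ℕ} {P : Set (EuclideanSpace ℝ (Fin n))}
    {X : Type*} [TopologicalSpace X] {φ : Z2Power (facets P) →* Z2Power (Fin n)}
    {Ψ : P × Z2Power (Fin n) → X} (h : IsMomentAngleQuotient φ Ψ) (hP : IsSimplePolytope P)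
    (x : X) : IsTwoNeighborly P ↔
      Nonempty (FundamentalGroup X x ≃* Z2Power (Fin ((facets P).ncard - n))) := by
  have hfin := hP.finite_facets_coe
  have hker : Nat.card φ.ker * 2 ^ n = 2 ^ (facets P).ncard := by
    have h1 := φ.ker.card_mul_index
    rwa [Subgroup.index_ker, MonoidHom.range_eq_top.mpr h.surjective, Subgroup.card_top,
      Z2Power.card_eq, Z2Power.card_eq, Nat.card_fin, Nat.card_coe_set_eq] at h1
  have hn : n ≤ (facets P).ncard :=
    (Nat.pow_dvd_pow_iff_le_right one_lt_two).mp (Dvd.intro_left _ hker)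
  have hpow : 2 ^ ((facets P).ncard - n) * 2 ^ n = 2 ^ (facets P).ncard := by
    rw [← pow_add, Nat.sub_add_cancel hn]
  constructor
  · intro hN
    obtain ⟨e⟩ := h.nonempty_mulEquiv hP hN x
    have hcard : Nat.card φ.ker = 2 ^ ((facets P).ncard - n) :=
      Nat.eq_of_mul_eq_mul_right (by positivity) (hker.trans hpow.symm)
    obtain ⟨e'⟩ := nonempty_mulEquiv_Z2Power
      (fun x : φ.ker => Subtype.ext (Z2Power.mul_self x.1)) hcard
    exact ⟨e.trans (MulOpposite.opMulEquiv.symm.trans e')⟩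
  · rintro ⟨e⟩
    by_contra hN
    obtain ⟨K, _, f, hf, hcard⟩ := h.exists_surjective hP hN x
    have hπ : Nat.card (FundamentalGroup X x) = 2 ^ ((facets P).ncard - n) := by
      rw [Nat.card_congr e.toEquiv, Z2Power.card_eq, Nat.card_fin]
    have : Finite (FundamentalGroup X x) := Finite.of_equiv _ e.symm.toEquiv
    have hle : Nat.card K ≤ 2 ^ ((facets P).ncard - n) :=
      hπ ▸ Nat.card_le_card_of_surjective f hf
    have h2 := Nat.mul_le_mul_right (2 ^ n) hle
    rw [Z2Power.card_eq, Nat.card_fin] at hcard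
    rw [hpow, hcard] at h2
    exact absurd ((Nat.pow_le_pow_iff_right one_lt_two).mp h2) (by omega)

end FundamentalGroups

theorem mainTheorem12 {n : ℕ} (P : Set (EuclideanSpace ℝ (Fin n))) (hP : IsSimplePolytope P) :
    (IsTwoNeighborly P ↔ SimplyConnectedSpace (RealMomentAngle P)) ∧
    ∀ (M : Type*) [TopologicalSpace M] [T2Space M] [CompactSpace M]
      [ChartedSpace (EuclideanSpace ℝ (Fin n)) M]
      [MulAction (Z2Power (Fin n)) M] [ContinuousConstSMul (Z2Power (Fin n)) M],
      IsSmallCover P M → ∀ x : M,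
        (IsTwoNeighborly P ↔
          Nonempty (FundamentalGroup M x ≃* Z2Power (Fin ((facets P).ncard - n)))) := by
  refine ⟨⟨fun hN => hN.simplyConnectedSpace hP, isTwoNeighborly_of_simplyConnectedSpace hP⟩, ?_⟩
  intro M _ _ _ _ _ _ hM x
  obtain ⟨hstd, h, hstab⟩ := hM
  obtain ⟨φ, Ψ, hΨ⟩ := exists_isMomentAngleQuotient hP hstd hstab
  exact hΨ.isTwoNeighborly_iff hP x
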